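/- Let $E$ be a separable infinite-dimensional complex Hilbert space and let $B\big((a,u),(b,v)\big)=a\bar b-\langle u,v\rangle$ on $\mathbb C\oplus E$ (linear in the first argument), a strongly non-degenerate Hermitian form of signature $(1,\infty)$. Let $\mathbf H^\infty_{\mathbb C}$ be the set of lines $[v]$ with $B(v,v)>0$, with the metric $\cosh d([v],[w])=|B(v,w)|/\sqrt{B(v,v)B(w,w)}$, let $\partial\mathbf H^\infty_{\mathbb C}$ be the set of isotropic lines, and let $\mathrm{Isom}(\mathbf H^\infty_{\mathbb C})_o=PU(1,\infty)$ be the group of projective transformations induced by linear automorphisms preserving $B$ (the holomorphic isometries). Define $\mathbf H^1_{\mathbb C}$ and $\mathrm{Isom}(\mathbf H^1_{\mathbb C})_o=PU(1,1)$ in the same way with $E$ replaced by $\mathbb C$; let $e_1,e_2$ be the standard basis of $\mathbb C^2$, $\xi_1=\frac1{\sqrt2}(e_1+e_2)$, $\xi_2=\frac1{\sqrt2}(e_1-e_2)$, and for $\lambda>0$, $b\in\mathbb R$ let $g(\lambda,b)\in SU(1,1)$ have the matrix $\begin{pmatrix}\lambda& ib\\0&\lambda^{-1}\end{pmatrix}$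 in the basis $\xi_1,\xi_2$; these elements form a group $P$. A representation is a homomorphism $\rho:\mathrm{Isom}(\mathbf H^1_{\mathbb C})_o\to\mathrm{Isom}(\mathbf H^\infty_{\mathbb C})_o$ all of whose orbit maps $g\mapsto\rho(g)x$, $x\in\mathbf H^\infty_{\mathbb C}$, are continuous. It is irreducible if it fixes no point of $\mathbf H^\infty_{\mathbb C}\cup\partial\mathbf H^\infty_{\mathbb C}$, preserves no pair of distinct points of $\partial\mathbf H^\infty_{\mathbb C}$, and preserves no proper complex hyperbolic subspace (the set of positive lines in a closed complex subspace on which $B$ is non-degenerate and takes a positive value). Let $\rho$ be irreducible. Choose isotropic vectors $\eta_1,\eta_2$ with $B(\eta_1,\eta_2)=1$ such that $[\eta_1]$ is fixed by $\rho(P)$ and $[\eta_2]$ is fixed by $\rho(g(\lambda,0))$ for all $\lambda>0$. Represent each isometry $\rho(g(\lambda,b))$ by the linear map $\tilde\rho(\lambda,b)$ preserving $B$ for which $B(\tilde\rho(\lambda,b)\eta_1,\eta_2)>0$. The displacement $\ell(\rho)$ is the number $t$ such that $\tilde\rho(\lambda,0)\eta_1=\lambda^t\eta_1$ for all $\lambda>0$,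 and the angular invariant is $\mathrm{Arg}(\rho)=\mathrm{Arg}(K(1))\in(-\pi,\pi]$, where $K(b)=B(\tilde\rho(1,b)\eta_2,\eta_2)$. Theorem. For every irreducible representation, $\ell(\rho)$ and $\mathrm{Arg}(\rho)$ are well defined: such $\eta_1,\eta_2$ and $t$ exist, and $\ell(\rho)$ and $\mathrm{Arg}(\rho)$ do not depend on the choices. Let $\rho_1,\rho_2$ be irreducible representations of $\mathrm{Isom}(\mathbf H^1_{\mathbb C})_o$ into $\mathrm{Isom}(\mathbf H^\infty_{\mathbb C})_o$. If $\ell(\rho_1)=\ell(\rho_2)$, then $\rho_1$ and $\rho_2$ are conjugate by an element of $\mathrm{Isom}(\mathbf H^\infty_{\mathbb C})_o$ if and only if $\mathrm{Arg}(\rho_1)=\mathrm{Arg}(\rho_2)$. Moreover $(\ell,\mathrm{Arg})$ is a complete invariant: $\rho_1$ and $\rho_2$ are conjugate by an element of $\mathrm{Isom}(\mathbf H^\infty_{\mathbb C})_o$ if and only if $\ell(\rho_1)=\ell(\rho_2)$ and $\mathrm{Arg}(\rho_1)=\mathrm{Arg}(\rho_2)$. -/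

import Mathlib

open scoped LinearAlgebra.Projectivization

noncomputable section

namespace CHyp

variable {E : Type*} [NormedAddCommGroup E] [InnerProductSpace ℂ E]

/-- The strongly non-degenerate Hermitian form `B((a, u), (b, v)) = a * conj b - ⟨u, v⟩` of
signature `(1, dim E)` on `ℂ × E`, linear in the first argument and antilinear in the second
(Mathlib's `inner` is antilinear in its first argument). -/
def form (x y : ℂ × E) : ℂ := x.1 * (starRingEnd ℂ) y.1 - inner ℂ y.2 x.2

variable (E) in
/-- The unitary group `U(1, dim E)` of the form. Its elements are automatically continuous when
`E` is a Hilbert space. -/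
def U : Subgroup ((ℂ × E) ≃ₗ[ℂ] (ℂ × E)) where
  carrier := {T | ∀ x y, form (T x) (T y) = form x y}
  one_mem' := fun _ _ => rfl
  mul_mem' := fun {S T} hS hT x y => by
    rw [LinearEquiv.mul_apply, LinearEquiv.mul_apply, hS, hT]
  inv_mem' := fun {T} hT x y => by
    have h := hT (T⁻¹ x) (T⁻¹ y)
    have e : ∀ z, T (T⁻¹ z) = z := fun z => T.apply_symm_apply z
    rw [e, e] at h
    exact h.symm

/-- The topology of pointwise convergence on `U(1, dim E)`. For finite-dimensional `E` it is the
usual topology of the matrix group. -/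
instance : TopologicalSpace (U E) :=
  TopologicalSpace.induced (fun (T : U E) (v : ℂ × E) => T.1 v) inferInstance

variable (E) in
/-- The group of holomorphic isometries `Isom(H)_o = PU(1, dim E)`, as the image of `U(1, dim E)`
in the group of permutations of the projective space of `ℂ × E`. -/
def PU : Subgroup (Equiv.Perm (ℙ ℂ (ℂ × E))) :=
  (MulAction.toPermHom ((ℂ × E) ≃ₗ[ℂ] (ℂ × E)) (ℙ ℂ (ℂ × E))).comp (U E).subtype |>.range

/-- The projectivization homomorphism `U(1, dim E) → PU(1, dim E)`. -/
def proj : U E →* PU E :=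
  ((MulAction.toPermHom ((ℂ × E) ≃ₗ[ℂ] (ℂ × E)) (ℙ ℂ (ℂ × E))).comp
    (U E).subtype).rangeRestrict

/-- The quotient topology on `PU(1, dim E)`. -/
instance : TopologicalSpace (PU E) := TopologicalSpace.coinduced proj inferInstance

variable (E) in
/-- The complex hyperbolic space: the set of positive lines. -/
def space : Set (ℙ ℂ (ℂ × E)) := {p | 0 < (form p.rep p.rep).re}

variable (E) in
/-- The boundary at infinity: the set of isotropic lines. -/
def boundary : Set (ℙ ℂ (ℂ × E)) := {p | form p.rep p.rep = 0}

/-- The hyperbolic distance, `cosh d([v],[w]) = |B(v,w)| / (B(v,v)^(1/2) * B(w,w)^(1/2))`. -/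
def hdist (p q : ℙ ℂ (ℂ × E)) : ℝ :=
  Real.arcosh (‖form p.rep q.rep‖ /
    (Real.sqrt (form p.rep p.rep).re * Real.sqrt (form q.rep q.rep).re))

variable (E) in
/-- A (continuous) representation of `Isom(H^1_ℂ)_o = PU(1,1)` into `Isom(H)_o = PU(1, dim E)`:
a homomorphism such that for each point `x` of the hyperbolic space the orbit map `g ↦ ρ(g) x` is
continuous for the hyperbolic distance. -/
structure Rep where
  /-- the underlying homomorphism -/
  hom : PU ℂ →* PU E
  continuous_orbit : ∀ x ∈ space E, ∀ g₀ : PU ℂ,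
    Filter.Tendsto (fun g => hdist ((hom g).1 x) ((hom g₀).1 x)) (nhds g₀) (nhds 0)

/-- No fixed point in the hyperbolic space or on its boundary, and no invariant pair of points of
the boundary. -/
def Rep.NonElementary (ρ : Rep E) : Prop :=
  (¬ ∃ p ∈ space E ∪ boundary E, ∀ g, (ρ.hom g).1 p = p) ∧
  ¬ ∃ p ∈ boundary E, ∃ q ∈ boundary E, p ≠ q ∧
    ∀ g, ((ρ.hom g).1 p = p ∧ (ρ.hom g).1 q = q) ∨ ((ρ.hom g).1 p = q ∧ (ρ.hom g).1 q = p)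

/-- `L` is a closed complex subspace on which the form is non-degenerate of signature `(1, m')`;
it represents a complex hyperbolic subspace. (As the ambient form has only one positive
direction, it is enough to ask for a positive vector.) -/
def IsHyperbolicSubspace (L : Submodule ℂ (ℂ × E)) : Prop :=
  IsClosed (L : Set (ℂ × E)) ∧ (∀ v ∈ L, (∀ w ∈ L, form v w = 0) → v = 0) ∧
    ∃ v ∈ L, 0 < (form v v).re

/-- Non-elementary, without proper invariant complex hyperbolic subspace. -/
def Rep.Irreducible (ρ : Rep E) : Prop :=
  ρ.NonElementary ∧ ∀ L : Submodule ℂ (ℂ × E), IsHyperbolicSubspace L →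
    (∀ g, ∀ p ∈ space E, p.submodule ≤ L → Projectivization.submodule ((ρ.hom g).1 p) ≤ L) →
    L = ⊤

/-- Conjugacy of representations in the target group `Isom(H)_o`. -/
def Rep.Conj (ρ₁ ρ₂ : Rep E) : Prop :=
  ∃ T : PU E, ∀ g, ρ₂.hom g = T * ρ₁.hom g * T⁻¹

/-- `ξ₁ = (e₁ + e₂) / √2`. -/
def xi₁ : ℂ × ℂ := ((Real.sqrt 2 : ℂ)⁻¹, (Real.sqrt 2 : ℂ)⁻¹)

/-- `ξ₂ = (e₁ - e₂) / √2`. -/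
def xi₂ : ℂ × ℂ := ((Real.sqrt 2 : ℂ)⁻¹, -(Real.sqrt 2 : ℂ)⁻¹)

/-- The linear map with matrix `(l, i b; 0, l⁻¹)` in the basis `ξ₁, ξ₂` of `ℂ × ℂ`. -/
def borelMap (l b : ℝ) (v : ℂ × ℂ) : ℂ × ℂ :=
  ((l : ℂ) * form v xi₂ + Complex.I * b * form v xi₁) • xi₁ + ((l : ℂ)⁻¹ * form v xi₁) • xi₂

theorem form_complex (x y : ℂ × ℂ) :
    form x y = x.1 * (starRingEnd ℂ) y.1 - x.2 * (starRingEnd ℂ) y.2 := by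
  simp only [form, RCLike.inner_apply']
  ring

theorem form_xi₁ (v : ℂ × ℂ) : form v xi₁ = (Real.sqrt 2 : ℂ)⁻¹ * (v.1 - v.2) := by
  simp only [form_complex, xi₁, map_inv₀, Complex.conj_ofReal]
  ring

theorem form_xi₂ (v : ℂ × ℂ) : form v xi₂ = (Real.sqrt 2 : ℂ)⁻¹ * (v.1 + v.2) := by
  simp only [form_complex, xi₂, map_inv₀, map_neg, Complex.conj_ofReal]
  ring

theorem sqrt_two_inv_mul : (Real.sqrt 2 : ℂ)⁻¹ * (Real.sqrt 2 : ℂ)⁻¹ = 1 / 2 := by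
  rw [← mul_inv, ← Complex.ofReal_mul, Real.mul_self_sqrt (by norm_num)]
  norm_num

theorem borelMap_eq (l b : ℝ) (v : ℂ × ℂ) : borelMap l b v =
    (((l : ℂ) * (v.1 + v.2) + Complex.I * b * (v.1 - v.2) + (l : ℂ)⁻¹ * (v.1 - v.2)) / 2,
     ((l : ℂ) * (v.1 + v.2) + Complex.I * b * (v.1 - v.2) - (l : ℂ)⁻¹ * (v.1 - v.2)) / 2) := by
  have h := sqrt_two_inv_mul
  simp only [borelMap, form_xi₁, form_xi₂]
  simp only [xi₁, xi₂]
  ext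
  · simp only [Prod.fst_add, Prod.smul_fst, smul_eq_mul]
    linear_combination ((l : ℂ) * (v.1 + v.2) + Complex.I * b * (v.1 - v.2)
      + (l : ℂ)⁻¹ * (v.1 - v.2)) * h
  · simp only [Prod.snd_add, Prod.smul_snd, smul_eq_mul]
    linear_combination ((l : ℂ) * (v.1 + v.2) + Complex.I * b * (v.1 - v.2)
      - (l : ℂ)⁻¹ * (v.1 - v.2)) * h

theorem borelMap_inv {l : ℝ} (hl : l ≠ 0) (b : ℝ) (v : ℂ × ℂ) :
    borelMap l⁻¹ (-b) (borelMap l b v) = v := by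
  have h : (l : ℂ) ≠ 0 := by exact_mod_cast hl
  rw [borelMap_eq, borelMap_eq]
  ext
  · push_cast
    field_simp
    ring
  · push_cast
    field_simp
    ring

theorem form_borelMap {l : ℝ} (hl : l ≠ 0) (b : ℝ) (v w : ℂ × ℂ) :
    form (borelMap l b v) (borelMap l b w) = form v w := by
  have h : (l : ℂ) ≠ 0 := by exact_mod_cast hl
  rw [borelMap_eq, borelMap_eq]
  simp only [form_complex, map_div₀, map_add, map_sub, map_mul, map_inv₀,
    Complex.conj_ofReal, Complex.conj_I, map_ofNat]
  field_simp
  ring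

/-- The element `g(l, b)` of `SU(1,1)`, with matrix `(l, i b; 0, l⁻¹)` in the basis `ξ₁, ξ₂`.
The elements `g(l, b)`, `l > 0`, form the group `P`, which projects isomorphically onto the
stabilizer of `[ξ₁]` in `PU(1,1)`. -/
def borel (l : ℝ) (hl : 0 < l) (b : ℝ) : U ℂ :=
  ⟨{ toFun := borelMap l b
     invFun := borelMap l⁻¹ (-b)
     map_add' := fun v w => by
       simp only [borelMap_eq, Prod.fst_add, Prod.snd_add, Prod.mk_add_mk]
       ext <;> ring
     map_smul' := fun c v => by
       simp only [borelMap_eq, Prod.smul_fst, Prod.smul_snd, smul_eq_mul, RingHom.id_apply,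
         Prod.smul_mk]
       ext <;> ring
     left_inv := borelMap_inv hl.ne' b
     right_inv := fun v => by
       simpa using borelMap_inv (inv_ne_zero hl.ne') (-b) v },
   form_borelMap hl.ne' b⟩

/-- `η₁, η₂` are isotropic with `B(η₁, η₂) = 1`, the point `[η₁]` is fixed by `ρ(P)`, and `[η₂]`
is the other end of the axis of the isometries `ρ(g(l, 0))`: it is fixed by all of them. Fixing a
line is expressed through an arbitrary linear representative `T`. -/
structure Rep.IsAxisPair (ρ : Rep E) (η₁ η₂ : ℂ × E) : Prop where
  isotropic₁ : form η₁ η₁ = 0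
  isotropic₂ : form η₂ η₂ = 0
  normalized : form η₁ η₂ = 1
  fixed₁ : ∀ (l : ℝ) (hl : 0 < l) (b : ℝ) (T : U E), proj T = ρ.hom (proj (borel l hl b)) →
    ∃ θ : ℂ, T.1 η₁ = θ • η₁
  fixed₂ : ∀ (l : ℝ) (hl : 0 < l) (T : U E), proj T = ρ.hom (proj (borel l hl 0)) →
    ∃ θ : ℂ, T.1 η₂ = θ • η₂

/-- `T` is the linear representative of the isometry `ρ(g(l, b))` normalized by the condition
that `B(T η₁, η₂)` is a positive real number. -/
def Rep.IsNormalizedLift (ρ : Rep E) (η₁ η₂ : ℂ × E) (l : ℝ) (hl : 0 < l) (b : ℝ) (T : U E) :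
    Prop :=
  proj T = ρ.hom (proj (borel l hl b)) ∧ ∃ r : ℝ, 0 < r ∧ form (T.1 η₁) η₂ = r

/-- `t` is the displacement of `ρ`: the isometry `ρ(g(l, 0))`, normalized, multiplies `η₁` by
`χ(l) = l ^ t`, for all `l > 0`. -/
def Rep.HasDisplacement (ρ : Rep E) (t : ℝ) : Prop :=
  ∃ η₁ η₂, ρ.IsAxisPair η₁ η₂ ∧ ∀ (l : ℝ) (hl : 0 < l) (T : U E),
    ρ.IsNormalizedLift η₁ η₂ l hl 0 T → T.1 η₁ = ((l ^ t : ℝ) : ℂ) • η₁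

/-- `θ` is the angular invariant of `ρ`: the argument of `K(1)`, where
`K(b) = B(ρ(g(1, b)) η₂, η₂)` for the normalized linear representative of `ρ(g(1, b))`. -/
def Rep.HasAngle (ρ : Rep E) (θ : ℝ) : Prop :=
  ∃ η₁ η₂, ρ.IsAxisPair η₁ η₂ ∧ ∃ T : U E,
    ρ.IsNormalizedLift η₁ η₂ 1 one_pos 1 T ∧ θ = Complex.arg (form (T.1 η₂) η₂)

/-- The displacement `ℓ(ρ)`. -/
def Rep.displacement (ρ : Rep E) : ℝ := Classical.epsilon ρ.HasDisplacement

/-- The angular invariant `Arg(ρ) = Arg(K(1))`. -/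
def Rep.angle (ρ : Rep E) : ℝ := Classical.epsilon ρ.HasAngle

end CHyp

end

/-!
The classification of irreducible representations of `PU(1,1)` into `PU(1,∞)` by their displacement
and angular invariant.

*Existence of the axis.* Let `a = ρ(g(2, 0))`. If an orbit of `a` is bounded, then `a` fixes a point
of the hyperbolic space, namely a circumcenter (`exists_fixed_of_bounded`). As conjugation by
`g(2, 0)⁻¹` contracts the `g(1, b)`, the Mautner argument shows that this point is fixed by the two
opposite unipotent groups, hence by all of `PU(1,1)`, which is impossible
(`Rep.NonElementary.diag_notMem_stab`). Otherwise the orbit, read in the ball model along the times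
of record displacement, is a Cauchy sequence, and its limit on the boundary is fixed by every
isometry that moves the points of the orbit by a bounded amount (`exists_limit_of_unbounded`). The
same contraction shows that all `ρ(g(l, b))` are of this kind. This limit and its image under the
Weyl element form an axis pair.

*Invariants.* The normalized representatives form a linear representation of the group of the
`g(l, b)`. It acts on `η₁` by a positive character, which is a power `l ^ t` by continuity, and the
unipotent elements fix `η₁`. Conjugation by `g(l, 0)` gives `K(l² b) = l ^ (2 t) K(b)`, so that `K`
is determined by `t` and `K(1)`, and `K(1) ≠ 0` because otherwise the pair of ends of the axis would
be invariant. As `a` fixes no other boundary points than the ends of the axis, `(η₁, η₂)` is unique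
up to a rescaling, which multiplies `K` by a positive constant.

*Classification.* By the Bruhat decomposition the orbit of `[η₁]` under `PU(1,1)` is represented by
`η₁` and the vectors `ρ(g(1, b)) η₂`. Its closed span is an invariant hyperbolic subspace, hence
everything, and its Gram matrix has the entries `0`, `1` and `K(b - b')`. If two representations
have the same invariants, then after a rescaling their Gram matrices agree, and a unitary map
carries one orbit to the other (`exists_unitary_of_form_eq`). It conjugates the representations:
both actions permute the lines of the orbit in the same way, and a unitary map that preserves these
lines is a scalar since the off-diagonal entries of the Gram matrix do not vanish
(`Rep.IsAxisPair.exists_eq_smul_of_orbit`).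
-/

namespace CHyp

open scoped ComplexConjugate

open Filter Topology

variable {E : Type*} [NormedAddCommGroup E] [InnerProductSpace ℂ E]

/-! ### The Hermitian form -/

theorem form_add_left (x y z : ℂ × E) : form (x + y) z = form x z + form y z := by
  simp only [form, Prod.fst_add, Prod.snd_add, inner_add_right]
  ring

theorem form_add_right (x y z : ℂ × E) : form x (y + z) = form x y + form x z := by
  simp only [form, Prod.fst_add, Prod.snd_add, inner_add_left, map_add]
  ring

theorem form_smul_left (c : ℂ) (x y : ℂ × E) : form (c • x) y = c * form x y := by
  simp only [form, Prod.smul_fst, Prod.smul_snd, inner_smul_right, smul_eq_mul]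
  ring

theorem form_smul_right (c : ℂ) (x y : ℂ × E) : form x (c • y) = conj c * form x y := by
  simp only [form, Prod.smul_fst, Prod.smul_snd, inner_smul_left, smul_eq_mul, map_mul]
  ring

theorem form_neg_left (x y : ℂ × E) : form (-x) y = -form x y := by
  simpa using form_smul_left (-1) x y

theorem form_neg_right (x y : ℂ × E) : form x (-y) = -form x y := by
  simpa using form_smul_right (-1) x y

theorem form_sub_left (x y z : ℂ × E) : form (x - y) z = form x z - form y z := by
  rw [sub_eq_add_neg, form_add_left, form_neg_left, sub_eq_add_neg]

theorem form_sub_right (x y z : ℂ × E) : form x (y - z) = form x y - form x z := by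
  rw [sub_eq_add_neg, form_add_right, form_neg_right, sub_eq_add_neg]

@[simp]
theorem form_zero_left (x : ℂ × E) : form 0 x = 0 := by simp [form]

@[simp]
theorem form_zero_right (x : ℂ × E) : form x 0 = 0 := by simp [form]

theorem conj_form (x y : ℂ × E) : conj (form x y) = form y x := by
  simp only [form, map_sub, map_mul, Complex.conj_conj, inner_conj_symm]
  ring

theorem norm_form_comm (x y : ℂ × E) : ‖form x y‖ = ‖form y x‖ := by
  rw [← conj_form, RCLike.norm_conj]

theorem form_self (x : ℂ × E) : form x x = ((‖x.1‖ ^ 2 - ‖x.2‖ ^ 2 : ℝ) : ℂ) := by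
  simp only [form, Complex.mul_conj, inner_self_eq_norm_sq_to_K, Complex.normSq_eq_norm_sq]
  push_cast
  rfl

theorem form_self_re (x : ℂ × E) : (form x x).re = ‖x.1‖ ^ 2 - ‖x.2‖ ^ 2 := by
  rw [form_self, Complex.ofReal_re]

theorem form_self_eq_re (x : ℂ × E) : form x x = ((form x x).re : ℂ) := by
  rw [form_self, Complex.ofReal_re]

theorem form_self_smul (c : ℂ) (x : ℂ × E) : form (c • x) (c • x) = (‖c‖ ^ 2 : ℝ) * form x x := by
  rw [form_smul_left, form_smul_right, ← mul_assoc, Complex.mul_conj, Complex.normSq_eq_norm_sq]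

theorem form_self_smul_re (c : ℂ) (x : ℂ × E) :
    (form (c • x) (c • x)).re = ‖c‖ ^ 2 * (form x x).re := by
  rw [form_self_smul, Complex.re_ofReal_mul]

theorem continuous_form : Continuous fun p : (ℂ × E) × (ℂ × E) => form p.1 p.2 := by
  unfold form
  fun_prop

theorem ne_zero_of_form_ne_zero {x y : ℂ × E} (h : form x y ≠ 0) : x ≠ 0 ∧ y ≠ 0 := by
  constructor <;> rintro rfl <;> simp at h

theorem eq_zero_of_forall_form_eq_zero {x : ℂ × E} (h : ∀ y, form x y = 0) : x = 0 := by
  have h1 := h (1, 0)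
  have h2 := h (0, x.2)
  simp only [form, map_one, mul_one, inner_zero_left, sub_zero, map_zero, mul_zero, zero_sub,
    neg_eq_zero, inner_self_eq_zero] at h1 h2
  exact Prod.ext h1 h2

variable (E) in
/-- The standard base point of the hyperbolic space, as a vector. -/
def basePt : ℂ × E := (1, 0)

theorem form_basePt_right (x : ℂ × E) : form x (basePt E) = x.1 := by simp [form, basePt]

theorem form_basePt_self : form (basePt E) (basePt E) = 1 := by simp [form, basePt]

theorem exists_norm_one_mul_eq_norm (c : ℂ) : ∃ u : ℂ, ‖u‖ = 1 ∧ u * c = ‖c‖ := by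
  by_cases hc : c = 0
  · exact ⟨1, by simp, by simp [hc]⟩
  · have h : (‖c‖ : ℂ) ≠ 0 := by exact_mod_cast norm_ne_zero_iff.2 hc
    refine ⟨conj c / ‖c‖, ?_, ?_⟩
    · rw [norm_div, RCLike.norm_conj, Complex.norm_real, norm_norm]
      exact div_self (by exact_mod_cast h)
    · rw [div_mul_eq_mul_div, mul_comm, Complex.mul_conj, Complex.normSq_eq_norm_sq,
        div_eq_iff h]
      push_cast
      ring

/-- The orthogonal complement of a positive vector is negative definite. -/
theorem form_self_neg_of_orthogonal {x v : ℂ × E} (hx : 0 < (form x x).re) (h : form v x = 0)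
    (hv : v ≠ 0) : (form v v).re < 0 := by
  rw [form_self_re] at *
  have h1 : v.1 * conj x.1 = inner ℂ x.2 v.2 := sub_eq_zero.1 h
  have h2 : ‖v.1‖ * ‖x.1‖ ≤ ‖x.2‖ * ‖v.2‖ := by
    have := norm_inner_le_norm (𝕜 := ℂ) x.2 v.2
    rwa [← h1, norm_mul, RCLike.norm_conj] at this
  have h3 : ‖x.2‖ < ‖x.1‖ := lt_of_pow_lt_pow_left₀ 2 (norm_nonneg _) (by linarith)
  have h4 : 0 < ‖v.2‖ := by
    rw [norm_pos_iff]
    intro h0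
    rw [h0, norm_zero, mul_zero] at h2
    have h5 : ‖v.1‖ = 0 := by
      by_contra h6
      have : 0 < ‖v.1‖ * ‖x.1‖ :=
        mul_pos (lt_of_le_of_ne (norm_nonneg _) (Ne.symm h6)) ((norm_nonneg _).trans_lt h3)
      linarith
    exact hv (Prod.ext (norm_eq_zero.1 h5) h0)
  have h5 : ‖v.1‖ < ‖v.2‖ := by
    by_contra! h6
    nlinarith [norm_nonneg x.1, norm_nonneg x.2]
  nlinarith [norm_nonneg v.1]

/-- Orthogonal isotropic vectors are proportional: the form has only one positive direction. -/
theorem exists_smul_eq_of_isotropic {x y : ℂ × E} (hx : form x x = 0) (hy : form y y = 0)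
    (h : form x y = 0) (hy0 : y ≠ 0) : ∃ θ : ℂ, x = θ • y := by
  have hy1 : y.1 ≠ 0 := by
    intro h1
    have := form_self_re y
    rw [hy, h1] at this
    simp at this
    exact hy0 (Prod.ext h1 this)
  refine ⟨x.1 / y.1, ?_⟩
  have hz : form (x - (x.1 / y.1) • y) (x - (x.1 / y.1) • y) = 0 := by
    rw [form_sub_left, form_sub_right, form_sub_right, form_smul_left, form_smul_left,
      form_smul_right, form_smul_right, hx, hy, h, ← conj_form x y, h]
    simp
  have h1 : (x - (x.1 / y.1) • y).1 = 0 := by simp [hy1]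
  have h2 := form_self_re (x - (x.1 / y.1) • y)
  rw [hz, h1] at h2
  simp only [Complex.zero_re, norm_zero, zero_sub, ne_eq, OfNat.ofNat_ne_zero, not_false_eq_true,
    zero_pow, zero_eq_neg, pow_eq_zero_iff, norm_eq_zero] at h2
  exact sub_eq_zero.1 (Prod.ext h1 h2)

theorem form_sub_proj_self {v x : ℂ × E} (hx : form x x = 1) :
    form (v - form v x • x) (v - form v x • x) = form v v - (‖form v x‖ ^ 2 : ℝ) := by
  have h : form v x * conj (form v x) = (‖form v x‖ ^ 2 : ℝ) := by
    rw [Complex.mul_conj, Complex.normSq_eq_norm_sq]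
  rw [form_sub_left, form_sub_right, form_sub_right, form_smul_left, form_smul_left,
    form_smul_right, form_smul_right, hx, ← conj_form v x, ← h]
  ring

theorem form_sub_proj {v x : ℂ × E} (hx : form x x = 1) : form (v - form v x • x) x = 0 := by
  rw [form_sub_left, form_smul_left, hx, mul_one, sub_self]

/-- The reverse Cauchy-Schwarz inequality for unit positive vectors. -/
theorem one_le_norm_form {v x : ℂ × E} (hv : form v v = 1) (hx : form x x = 1) :
    1 ≤ ‖form v x‖ := by
  by_cases h0 : v - form v x • x = 0
  · have h := form_sub_proj_self (v := v) hx
    rw [h0, hv, form_zero_left] at h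
    have : ‖form v x‖ ^ 2 = 1 := by exact_mod_cast (sub_eq_zero.1 h.symm).symm
    nlinarith [norm_nonneg (form v x)]
  · have h := form_self_neg_of_orthogonal (by rw [hx]; simp) (form_sub_proj (v := v) hx) h0
    rw [form_sub_proj_self hx, hv, Complex.sub_re, Complex.ofReal_re, Complex.one_re] at h
    nlinarith [norm_nonneg (form v x)]

theorem eq_smul_of_norm_form_eq_one {v x : ℂ × E} (hv : form v v = 1) (hx : form x x = 1)
    (h : ‖form v x‖ = 1) : v = form v x • x := by
  by_contra h0
  have h1 := form_self_neg_of_orthogonal (by rw [hx]; simp) (form_sub_proj (v := v) hx)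
    (sub_ne_zero.2 h0)
  rw [form_sub_proj_self hx, hv, Complex.sub_re, Complex.ofReal_re, Complex.one_re, h] at h1
  norm_num at h1

/-! ### The unitary group and its projectivization -/

theorem form_map (T : U E) (x y : ℂ × E) : form (T.1 x) (T.1 y) = form x y := T.2 x y

theorem coe_mul_apply (S T : U E) (v : ℂ × E) : (S * T).1 v = S.1 (T.1 v) := rfl

theorem coe_inv_apply_apply (T : U E) (v : ℂ × E) : (T⁻¹).1 (T.1 v) = v :=
  T.1.symm_apply_apply v

theorem coe_apply_inv_apply (T : U E) (v : ℂ × E) : T.1 ((T⁻¹).1 v) = v :=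
  T.1.apply_symm_apply v

theorem form_inv_left (T : U E) (x y : ℂ × E) : form ((T⁻¹).1 x) y = form x (T.1 y) := by
  rw [← form_map T, coe_apply_inv_apply]

theorem map_ne_zero' (T : U E) {v : ℂ × E} (hv : v ≠ 0) : T.1 v ≠ 0 :=
  fun h => hv (T.1.map_eq_zero_iff.1 h)

/-- Elements of the unitary group are continuous, by the closed graph theorem. -/
theorem continuous_coe [CompleteSpace E] (T : U E) : Continuous T.1 := by
  refine T.1.toLinearMap.continuous_of_seq_closed_graph fun u x y hu hTu => ?_
  rw [← sub_eq_zero]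
  refine eq_zero_of_forall_form_eq_zero fun z => ?_
  obtain ⟨z, rfl⟩ := T.1.surjective z
  have h1 : Filter.Tendsto (fun n => form (T.1 (u n)) (T.1 z)) Filter.atTop
      (nhds (form y (T.1 z))) :=
    (continuous_form.comp (continuous_id.prodMk continuous_const)).continuousAt.tendsto.comp hTu
  have h2 : Filter.Tendsto (fun n => form (T.1 (u n)) (T.1 z)) Filter.atTop
      (nhds (form x z)) := by
    simp only [form_map]
    exact (continuous_form.comp
      (continuous_id.prodMk continuous_const)).continuousAt.tendsto.comp hu
  rw [form_sub_left, tendsto_nhds_unique h1 h2]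
  change _ - form (T.1 x) (T.1 z) = 0
  rw [form_map, sub_self]

/-- Multiplication by a number of modulus one, as an element of the unitary group. -/
noncomputable def phase (c : ℂ) (hc : ‖c‖ = 1) : U E :=
  ⟨LinearEquiv.smulOfNeZero ℂ (ℂ × E) c (by rintro rfl; simp at hc), fun x y => by
    change form (c • x) (c • y) = _
    rw [form_smul_left, form_smul_right, ← mul_assoc, Complex.mul_conj,
      Complex.normSq_eq_norm_sq, hc]
    simp⟩

theorem phase_apply (c : ℂ) (hc : ‖c‖ = 1) (v : ℂ × E) : (phase c hc).1 v = c • v := rfl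

theorem proj_mk (T : U E) (v : ℂ × E) (hv : v ≠ 0) :
    (proj T).1 (.mk ℂ v hv) = .mk ℂ (T.1 v) (map_ne_zero' T hv) := rfl

theorem exists_proj_eq (g : PU E) : ∃ T, proj T = g :=
  MonoidHom.rangeRestrict_surjective _ g

theorem PU_mul_apply (g h : PU E) (p : ℙ ℂ (ℂ × E)) : (g * h).1 p = g.1 (h.1 p) := rfl

theorem PU_inv_apply (g : PU E) (p : ℙ ℂ (ℂ × E)) : (g⁻¹).1 (g.1 p) = p :=
  g.1.symm_apply_apply p

theorem proj_fixes_iff (T : U E) (v : ℂ × E) (hv : v ≠ 0) :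
    (proj T).1 (.mk ℂ v hv) = .mk ℂ v hv ↔ ∃ θ : ℂ, T.1 v = θ • v := by
  rw [proj_mk, Projectivization.mk_eq_mk_iff']
  exact exists_congr fun _ => eq_comm

/-- The form determines the phase: unitary maps inducing the same projective transformation
differ by a scalar of modulus one. -/
theorem eq_smul_of_proj_eq {S T : U E} (h : proj S = proj T) :
    ∃ c : ℂ, ‖c‖ = 1 ∧ ∀ v, S.1 v = c • T.1 v := by
  have hl : ∀ v : ℂ × E, v ≠ 0 → ∃ a : ℂ, (T⁻¹ * S).1 v = a • v := fun v hv => by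
    rw [← proj_fixes_iff _ v hv, map_mul, h, map_inv, inv_mul_cancel]
    rfl
  obtain ⟨c, hc⟩ := LinearMap.exists_eq_smul_id_of_forall_notLinearIndependent
    (f := (T⁻¹ * S).1.toLinearMap) fun v hv => by
      by_cases h0 : v = 0
      · subst h0
        have := hv.ne_zero 0
        simp at this
      · obtain ⟨a, ha⟩ := hl v h0
        rw [LinearIndependent.pair_iff] at hv
        have := hv a (-1) (by rw [LinearEquiv.coe_coe, ha]; simp)
        simp at this
  have hc' : ∀ v, (T⁻¹ * S).1 v = c • v := fun v => by
    simpa using congrArg (fun f : (ℂ × E) →ₗ[ℂ] (ℂ × E) => f v) hc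
  refine ⟨c, ?_, fun v => ?_⟩
  · have h1 := form_map (T⁻¹ * S) (basePt E) (basePt E)
    rw [hc', form_self_smul, form_basePt_self, mul_one] at h1
    have h2 : ‖c‖ ^ 2 = 1 := by exact_mod_cast h1
    exact (pow_eq_one_iff_of_nonneg (norm_nonneg c) two_ne_zero).1 h2
  · rw [← map_smul, ← hc' v, coe_mul_apply, coe_apply_inv_apply]

theorem proj_eq_of_eq_smul {S T : U E} {c : ℂ} (h : ∀ v, S.1 v = c • T.1 v) :
    proj S = proj T := by
  apply Subtype.ext
  ext p
  induction p using Projectivization.ind with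
  | h v hv =>
    rw [proj_mk, proj_mk, Projectivization.mk_eq_mk_iff']
    exact ⟨c, (h v).symm⟩

theorem mk_mem_space_iff (v : ℂ × E) (hv : v ≠ 0) :
    Projectivization.mk ℂ v hv ∈ space E ↔ 0 < (form v v).re := by
  obtain ⟨a, ha⟩ := Projectivization.exists_smul_eq_mk_rep ℂ v hv
  rw [space, Set.mem_ofPred_eq, ← ha, Units.smul_def, form_self_smul_re]
  have : 0 < ‖(a : ℂ)‖ ^ 2 := by have := a.ne_zero; positivity
  exact mul_pos_iff_of_pos_left this

theorem mk_mem_boundary_iff (v : ℂ × E) (hv : v ≠ 0) :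
    Projectivization.mk ℂ v hv ∈ boundary E ↔ form v v = 0 := by
  obtain ⟨a, ha⟩ := Projectivization.exists_smul_eq_mk_rep ℂ v hv
  rw [boundary, Set.mem_ofPred_eq, ← ha, Units.smul_def, form_self_smul]
  have := a.ne_zero
  simp

theorem hdist_mk (v w : ℂ × E) (hv : v ≠ 0) (hw : w ≠ 0) (hv1 : form v v = 1)
    (hw1 : form w w = 1) :
    hdist (.mk ℂ v hv) (.mk ℂ w hw) = Real.arcosh ‖form v w‖ := by
  obtain ⟨a, ha⟩ := Projectivization.exists_smul_eq_mk_rep ℂ v hv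
  obtain ⟨b, hb⟩ := Projectivization.exists_smul_eq_mk_rep ℂ w hw
  rw [hdist, ← ha, ← hb, Units.smul_def, Units.smul_def, form_self_smul_re, form_self_smul_re,
    hv1, hw1, Complex.one_re, mul_one, mul_one, Real.sqrt_sq (norm_nonneg _),
    Real.sqrt_sq (norm_nonneg _), form_smul_left, form_smul_right, norm_mul, norm_mul,
    RCLike.norm_conj]
  have := a.ne_zero
  have := b.ne_zero
  congr 1
  field_simp

/-- The half-turn about the positive vector `x + y`, that is, `1` on this vector and `-1` on its
orthogonal complement, exchanges the unit positive vectors `x` and `y` if `B(x, y) ≥ 0`. -/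
theorem exists_map_eq_of_form_nonneg {x y : ℂ × E} (hx : form x x = 1) (hy : form y y = 1)
    {r : ℝ} (hr : 0 ≤ r) (h : form x y = r) : ∃ T : U E, T.1 x = y := by
  set z := x + y with hz
  have hyx : form y x = r := by rw [← conj_form, h, Complex.conj_ofReal]
  have hzz : form z z = 2 * (1 + r) := by
    rw [hz, form_add_left, form_add_right, form_add_right, hx, hy, h, hyx]
    ring
  have hn : (1 + r : ℂ) ≠ 0 := by
    have : (1 + r : ℝ) ≠ 0 := by positivity
    exact_mod_cast this
  let R : (ℂ × E) →ₗ[ℂ] (ℂ × E) :=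
    { toFun := fun v => (form v z / (1 + r)) • z - v
      map_add' := fun v w => by
        simp only [form_add_left, add_div, add_smul]
        abel
      map_smul' := fun c v => by
        simp only [form_smul_left, smul_sub, smul_smul, RingHom.id_apply]
        congr 2
        ring }
  have hR : ∀ v, R v = (form v z / (1 + r)) • z - v := fun _ => rfl
  have hRR : ∀ v, R (R v) = v := fun v => by
    have : form (R v) z = form v z := by
      rw [hR, form_sub_left, form_smul_left, hzz]
      field_simp
      ring
    rw [hR (R v), this, hR]
    abel
  refine ⟨⟨LinearEquiv.ofInvolutive R hRR, fun v w => ?_⟩, ?_⟩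
  · change form (R v) (R w) = _
    rw [hR, hR, form_sub_left, form_sub_right, form_sub_right, form_smul_left, form_smul_right,
      form_smul_left, form_smul_right, hzz, ← conj_form w z]
    simp only [map_div₀, map_add, map_one, Complex.conj_ofReal]
    field_simp
    ring
  · change R x = y
    have : form x z = 1 + r := by rw [hz, form_add_right, hx, h]
    rw [hR, this, div_self hn, one_smul, hz, add_sub_cancel_left]

/-- The unitary group is transitive on unit positive vectors. -/
theorem exists_map_eq_basePt {x : ℂ × E} (hx : form x x = 1) : ∃ T : U E, T.1 x = basePt E := by
  obtain ⟨c, hc, h⟩ := exists_norm_one_mul_eq_norm (form x (basePt E))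
  obtain ⟨T, hT⟩ := exists_map_eq_of_form_nonneg (x := (phase c hc).1 x) (y := basePt E)
    (by rw [form_map, hx]) form_basePt_self (norm_nonneg _) (by
      rw [phase_apply, form_smul_left, h])
  exact ⟨T * phase c hc, hT⟩

/-! ### The structure of `PU(1,1)` -/

theorem form_xi₁_xi₁ : form xi₁ xi₁ = 0 := by rw [form_xi₁]; simp [xi₁]

theorem form_xi₂_xi₂ : form xi₂ xi₂ = 0 := by rw [form_xi₂]; simp [xi₂]

theorem form_xi₁_xi₂ : form xi₁ xi₂ = 1 := by
  rw [form_xi₂, xi₁]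
  linear_combination 2 * sqrt_two_inv_mul

theorem form_xi₂_xi₁ : form xi₂ xi₁ = 1 := by
  rw [← conj_form, form_xi₁_xi₂, map_one]

theorem borel_apply {l : ℝ} (hl : 0 < l) (b : ℝ) (v : ℂ × ℂ) :
    (borel l hl b).1 v = borelMap l b v := rfl

theorem eq_form_smul_xi (v : ℂ × ℂ) : v = form v xi₂ • xi₁ + form v xi₁ • xi₂ := by
  have h : borelMap 1 0 v = v := by
    rw [borelMap_eq]
    ext <;> simp
  conv_lhs => rw [← h]
  simp [borelMap]

theorem borel_mul {l l' : ℝ} (hl : 0 < l) (hl' : 0 < l') (b b' : ℝ) :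
    borel l hl b * borel l' hl' b' = borel (l * l') (mul_pos hl hl') (l * b' + b / l') := by
  apply Subtype.ext
  ext1 v
  change borelMap l b (borelMap l' b' v) = borelMap _ _ v
  have h : (l : ℂ) ≠ 0 := by exact_mod_cast hl.ne'
  have h' : (l' : ℂ) ≠ 0 := by exact_mod_cast hl'.ne'
  rw [borelMap_eq, borelMap_eq, borelMap_eq]
  push_cast
  ext
  · field_simp
    ring
  · field_simp
    ring

/-- The isometry `diag(1, -1)` of `ℂ × ℂ`. It exchanges `ξ₁` and `ξ₂`, so that it represents the
nontrivial element of the Weyl group of `PU(1,1)`. -/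
def weyl : U ℂ :=
  ⟨{ toFun := fun v => (v.1, -v.2)
     invFun := fun v => (v.1, -v.2)
     map_add' := fun v w => by ext <;> simp [add_comm]
     map_smul' := fun c v => by ext <;> simp
     left_inv := fun v => by simp
     right_inv := fun v => by simp }, fun v w => by
    change form (v.1, -v.2) (w.1, -w.2) = _
    simp [form_complex]⟩

theorem weyl_apply (v : ℂ × ℂ) : weyl.1 v = (v.1, -v.2) := rfl

theorem weyl_mul_self : weyl * weyl = 1 := by
  apply Subtype.ext
  ext1 v
  change weyl.1 (weyl.1 v) = v
  simp [weyl_apply]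

theorem weyl_xi₁ : weyl.1 xi₁ = xi₂ := rfl

theorem weyl_mul_diag {l : ℝ} (hl : 0 < l) :
    weyl * borel l hl 0 = borel l⁻¹ (inv_pos.2 hl) 0 * weyl := by
  apply Subtype.ext
  ext1 v
  change weyl.1 (borelMap l 0 v) = borelMap l⁻¹ 0 (weyl.1 v)
  have h : (l : ℂ) ≠ 0 := by exact_mod_cast hl.ne'
  simp only [weyl_apply, borelMap_eq]
  push_cast
  ext
  · field_simp
    ring
  · field_simp
    ring

theorem borel_one_zero : borel 1 one_pos 0 = 1 := by
  apply Subtype.ext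
  ext1 v
  change borelMap 1 0 v = v
  rw [borelMap_eq]
  ext <;> simp

theorem borel_congr {l l' b b' : ℝ} (hl : 0 < l) (h : l = l') (h' : b = b') :
    borel l hl b = borel l' (h ▸ hl) b' := by
  subst h h'
  rfl

theorem borel_inv {l : ℝ} (hl : 0 < l) (b : ℝ) :
    (borel l hl b)⁻¹ = borel l⁻¹ (inv_pos.2 hl) (-b) := by
  refine inv_eq_of_mul_eq_one_left ?_
  rw [borel_mul, ← borel_one_zero]
  refine borel_congr _ (inv_mul_cancel₀ hl.ne') ?_
  field_simp
  ring

/-- The stabilizer of `[ξ₁]` in `PU(1,1)` is the image of the group of the `g(l, b)`. -/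
theorem exists_borel_of_fixes {T : U ℂ} {c : ℂ} (h : T.1 xi₁ = c • xi₁) :
    ∃ (l : ℝ) (hl : 0 < l) (b : ℝ), proj T = proj (borel l hl b) := by
  set α := form (T.1 xi₂) xi₂ with hα
  set β := form (T.1 xi₂) xi₁ with hβ
  have h2 : T.1 xi₂ = α • xi₁ + β • xi₂ := eq_form_smul_xi _
  have h3 : c * conj β = 1 := by
    have := form_map T xi₁ xi₂
    rwa [h, h2, form_smul_left, form_add_right, form_smul_right, form_smul_right,
      form_xi₁_xi₁, form_xi₁_xi₂, mul_zero, zero_add, mul_one] at this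
  have h4 : α * conj β + β * conj α = 0 := by
    have := form_map T xi₂ xi₂
    rw [h2, form_add_left, form_add_right, form_add_right, form_smul_left, form_smul_left,
      form_smul_left, form_smul_left, form_smul_right, form_smul_right, form_smul_right,
      form_smul_right, form_xi₁_xi₁, form_xi₁_xi₂, form_xi₂_xi₂, form_xi₂_xi₁] at this
    simpa using this
  have h5 : (α * conj β).re = 0 := by
    have : ((2 * (α * conj β).re : ℝ) : ℂ) = 0 := by
      rw [← Complex.add_conj, map_mul, Complex.conj_conj, mul_comm (conj α)]
      exact h4
    have : 2 * (α * conj β).re = 0 := by exact_mod_cast this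
    linarith
  set y := (α * conj β).im with hy
  have h6 : α * conj β = Complex.I * y := by
    apply Complex.ext <;> simp [h5, hy]
  have hc : c ≠ 0 := left_ne_zero_of_mul_eq_one h3
  have hn : 0 < ‖c‖ := norm_pos_iff.2 hc
  have hn' : (‖c‖ : ℂ) ≠ 0 := by exact_mod_cast hn.ne'
  have hcc : c * conj c = ‖c‖ ^ 2 := by
    rw [Complex.mul_conj, Complex.normSq_eq_norm_sq]
    push_cast
    rfl
  have hα' : α = c * (Complex.I * y) := by
    linear_combination c * h6 - α * h3
  have hβ' : β = c / ‖c‖ ^ 2 := by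
    rw [eq_div_iff (pow_ne_zero 2 hn')]
    have : conj c * β = 1 := by
      have := congrArg conj h3
      rwa [map_mul, Complex.conj_conj, map_one] at this
    linear_combination -β * hcc + c * this
  refine ⟨‖c‖, hn, y * ‖c‖, proj_eq_of_eq_smul (c := c / ‖c‖) fun v => ?_⟩
  conv_lhs => rw [eq_form_smul_xi v]
  rw [map_add, map_smul, map_smul, h, h2, borel_apply, borelMap, hα', hβ']
  simp only [smul_add, smul_smul, ← add_assoc, ← add_smul]
  congr 2
  · push_cast
    field_simp
  · field_simp

/-- The Bruhat decomposition of `PU(1,1)`. -/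
theorem bruhat (g : PU ℂ) :
    (∃ (l : ℝ) (hl : 0 < l) (b : ℝ), g = proj (borel l hl b)) ∨
    ∃ (s l : ℝ) (hl : 0 < l) (b : ℝ),
      g = proj (borel 1 one_pos s) * proj weyl * proj (borel l hl b) := by
  obtain ⟨T, rfl⟩ := exists_proj_eq g
  set α := form (T.1 xi₁) xi₂ with hα
  set β := form (T.1 xi₁) xi₁ with hβ
  have h2 : T.1 xi₁ = α • xi₁ + β • xi₂ := eq_form_smul_xi _
  by_cases hβ0 : β = 0
  · exact Or.inl (exists_borel_of_fixes (c := α) (by rw [h2, hβ0]; simp))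
  refine Or.inr ?_
  have h4 : α * conj β + β * conj α = 0 := by
    have := form_map T xi₁ xi₁
    rw [h2, form_add_left, form_add_right, form_add_right, form_smul_left, form_smul_left,
      form_smul_left, form_smul_left, form_smul_right, form_smul_right, form_smul_right,
      form_smul_right, form_xi₁_xi₁, form_xi₁_xi₂, form_xi₂_xi₂, form_xi₂_xi₁] at this
    simpa using this
  have hcβ : conj β ≠ 0 := by simpa using hβ0
  have h5 : (α / β).re = 0 := by
    have : ((2 * (α / β).re : ℝ) : ℂ) = 0 := by
      rw [← Complex.add_conj, map_div₀]
      field_simp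
      linear_combination h4
    have : 2 * (α / β).re = 0 := by exact_mod_cast this
    linarith
  have h6 : α = β * (Complex.I * (α / β).im) := by
    have : α / β = Complex.I * (α / β).im := by
      apply Complex.ext <;> simp [h5]
    rw [← this]
    field_simp
  set s := (α / β).im
  have h7 : T.1 xi₁ = β • (borel 1 one_pos s * weyl).1 xi₁ := by
    rw [coe_mul_apply, weyl_xi₁, borel_apply, borelMap, form_xi₂_xi₁, form_xi₂_xi₂, h2, h6]
    simp [smul_smul]
  obtain ⟨l, hl, b, h⟩ := exists_borel_of_fixes (T := (borel 1 one_pos s * weyl)⁻¹ * T) (c := β)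
    (by rw [coe_mul_apply, h7, map_smul, coe_inv_apply_apply])
  refine ⟨s, l, hl, b, ?_⟩
  rw [← h, ← map_mul, ← map_mul, mul_inv_cancel_left]

theorem borel_eq_unip_mul_diag {l : ℝ} (hl : 0 < l) (b : ℝ) :
    borel l hl b = borel 1 one_pos (l * b) * borel l hl 0 := by
  rw [borel_mul]
  refine borel_congr _ (one_mul l).symm ?_
  field_simp
  ring

/-- The decomposition of the diagonal elements into unipotent ones. -/
theorem diag_mul_weyl {b : ℝ} (hb : 0 < b) :
    proj (borel b hb 0) * proj weyl = proj (borel 1 one_pos b) *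
      (proj weyl * proj (borel 1 one_pos b⁻¹) * proj weyl) * proj (borel 1 one_pos b) := by
  have h : (b : ℂ) ≠ 0 := by exact_mod_cast hb.ne'
  simp only [← map_mul]
  refine proj_eq_of_eq_smul (c := -Complex.I) fun v => ?_
  simp only [coe_mul_apply, borel_apply, weyl_apply, borelMap_eq]
  push_cast
  ext
  · simp only [Prod.smul_fst, smul_eq_mul]
    field_simp
    ring_nf
    simp only [Complex.I_sq, Complex.I_pow_three, Complex.I_pow_four]
    ring
  · simp only [Prod.smul_snd, smul_eq_mul]
    field_simp
    ring_nf
    simp only [Complex.I_sq, Complex.I_pow_three, Complex.I_pow_four]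
    ring

theorem eq_top_of_borel_weyl {H : Subgroup (PU ℂ)}
    (hP : ∀ (l : ℝ) (hl : 0 < l) (b : ℝ), proj (borel l hl b) ∈ H) (hw : proj weyl ∈ H) :
    H = ⊤ := by
  refine (Subgroup.eq_top_iff' H).2 fun g => ?_
  obtain ⟨l, hl, b, rfl⟩ | ⟨s, l, hl, b, rfl⟩ := bruhat g
  · exact hP l hl b
  · exact H.mul_mem (H.mul_mem (hP _ _ _) hw) (hP _ _ _)

/-- The two opposite unipotent subgroups generate `PU(1,1)`. -/
theorem eq_top_of_unipotent {H : Subgroup (PU ℂ)}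
    (hN : ∀ b : ℝ, proj (borel 1 one_pos b) ∈ H)
    (hN' : ∀ b : ℝ, proj weyl * proj (borel 1 one_pos b) * proj weyl ∈ H) : H = ⊤ := by
  have h1 : ∀ (l : ℝ) (hl : 0 < l), proj (borel l hl 0) * proj weyl ∈ H := fun l hl => by
    rw [diag_mul_weyl]
    exact H.mul_mem (H.mul_mem (hN _) (hN' _)) (hN _)
  have hw : proj weyl ∈ H := by
    simpa [borel_one_zero] using h1 1 one_pos
  refine eq_top_of_borel_weyl (fun l hl b => ?_) hw
  rw [borel_eq_unip_mul_diag, map_mul]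
  exact H.mul_mem (hN _) ((H.mul_mem_cancel_right hw).1 (h1 l hl))

/-- Conjugation by the inverses of the powers of `g(2, 0)` contracts the unipotent part. -/
theorem diag_pow_conj {l : ℝ} (hl : 0 < l) (b : ℝ) (k : ℕ) :
    (borel 2 two_pos 0 ^ k)⁻¹ * borel l hl b * borel 2 two_pos 0 ^ k
      = borel l hl (b * (1 / 4) ^ k) := by
  induction k generalizing b with
  | zero => simp
  | succ k ih =>
    rw [pow_succ', mul_inv_rev]
    have : (borel 2 two_pos 0)⁻¹ * borel l hl b * borel 2 two_pos 0 = borel l hl (b * (1 / 4)) := by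
      rw [borel_inv, borel_mul, borel_mul]
      refine borel_congr _ ?_ ?_
      · field_simp
      · field_simp
        ring
    rw [show (borel 2 two_pos 0 ^ k)⁻¹ * (borel 2 two_pos 0)⁻¹ * borel l hl b *
        (borel 2 two_pos 0 * borel 2 two_pos 0 ^ k) = (borel 2 two_pos 0 ^ k)⁻¹ *
        ((borel 2 two_pos 0)⁻¹ * borel l hl b * borel 2 two_pos 0) * borel 2 two_pos 0 ^ k by
      group, this, ih]
    exact borel_congr _ rfl (by ring)

theorem continuous_proj_borel {X : Type*} [TopologicalSpace X] {l b : X → ℝ} (hl : ∀ x, 0 < l x)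
    (hlc : Continuous l) (hbc : Continuous b) :
    Continuous fun x => proj (borel (l x) (hl x) (b x)) := by
  have h1 : Continuous (proj : U ℂ → PU ℂ) := continuous_coinduced_rng
  refine h1.comp ?_
  rw [continuous_induced_rng, continuous_pi_iff]
  intro v
  have h2 : Continuous fun x => (l x : ℂ)⁻¹ :=
    (Complex.continuous_ofReal.comp hlc).inv₀ fun x => by
      simpa using (hl x).ne'
  change Continuous fun x => borelMap (l x) (b x) v
  simp only [borelMap_eq]
  fun_prop

/-! ### Convergence in the ball model -/

/-- The point of the unit ball of `E` that represents the line of `v`. -/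
noncomputable def ballPt (v : ℂ × E) : E := (v.1)⁻¹ • v.2

theorem one_le_norm_fst {v : ℂ × E} (hv : form v v = 1) : 1 ≤ ‖v.1‖ := by
  simpa [form_basePt_right] using one_le_norm_form hv form_basePt_self

theorem fst_ne_zero {v : ℂ × E} (hv : form v v = 1) : v.1 ≠ 0 :=
  norm_pos_iff.1 (one_pos.trans_le (one_le_norm_fst hv))

theorem smul_eq_ballPt {v : ℂ × E} (hv : form v v = 1) : (v.1)⁻¹ • v = (1, ballPt v) :=
  Prod.ext (inv_mul_cancel₀ (fst_ne_zero hv)) rfl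

theorem form_ballPt_self {v : ℂ × E} (hv : form v v = 1) :
    form ((1 : ℂ), ballPt v) (1, ballPt v) = ((‖v.1‖⁻¹ ^ 2 : ℝ) : ℂ) := by
  rw [← smul_eq_ballPt hv, form_self_smul, hv, mul_one, norm_inv]

theorem norm_ballPt_sq {v : ℂ × E} (hv : form v v = 1) : ‖ballPt v‖ ^ 2 = 1 - ‖v.1‖⁻¹ ^ 2 := by
  have h := form_self_re ((1 : ℂ), ballPt v)
  rw [form_ballPt_self hv, Complex.ofReal_re] at h
  simp only [norm_one] at h
  linarith

/-- Comparison of the distance in the ball with the form: the form is the opposite of the squared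
norm on differences of vectors with the same first coordinate. -/
theorem norm_ballPt_sub_sq_le {v w : ℂ × E} (hv : form v v = 1) (hw : form w w = 1) :
    ‖ballPt v - ballPt w‖ ^ 2
      ≤ 2 * (‖v.1‖⁻¹ * ‖w.1‖⁻¹ * ‖form v w‖) - ‖v.1‖⁻¹ ^ 2 - ‖w.1‖⁻¹ ^ 2 := by
  set y : ℂ × E := (1, ballPt v) with hy
  set z : ℂ × E := (1, ballPt w) with hz
  have h1 : (form (y - z) (y - z)).re = -‖ballPt v - ballPt w‖ ^ 2 := by
    rw [form_self_re]
    simp [hy, hz]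
  have h2 : (form (y - z) (y - z)).re
      = ‖v.1‖⁻¹ ^ 2 - 2 * (form y z).re + ‖w.1‖⁻¹ ^ 2 := by
    have h : (form z y).re = (form y z).re := by rw [← conj_form, Complex.conj_re]
    rw [form_sub_left, form_sub_right, form_sub_right, Complex.sub_re, Complex.sub_re,
      Complex.sub_re, form_ballPt_self hv, form_ballPt_self hw, h, Complex.ofReal_re,
      Complex.ofReal_re]
    ring
  have h3 : (form y z).re ≤ ‖v.1‖⁻¹ * ‖w.1‖⁻¹ * ‖form v w‖ := by
    refine (Complex.re_le_norm _).trans (le_of_eq ?_)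
    rw [hy, hz, ← smul_eq_ballPt hv, ← smul_eq_ballPt hw, form_smul_left, form_smul_right,
      norm_mul, norm_mul, RCLike.norm_conj, norm_inv, norm_inv, mul_assoc]
  linarith

theorem inv_norm_fst_le_one {v : ℂ × E} (hv : form v v = 1) : ‖v.1‖⁻¹ ≤ 1 :=
  inv_le_one_of_one_le₀ (one_le_norm_fst hv)

theorem form_inv_sqrt_smul_self {z : ℂ × E} {a : ℝ} (ha : 0 < a) (hz : form z z = a) :
    form (((Real.sqrt a)⁻¹ : ℂ) • z) (((Real.sqrt a)⁻¹ : ℂ) • z) = 1 := by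
  rw [form_self_smul, hz, norm_inv, Complex.norm_real, Real.norm_of_nonneg (Real.sqrt_nonneg a),
    inv_pow, Real.sq_sqrt ha.le]
  norm_cast
  exact inv_mul_cancel₀ ha.ne'

/-! ### Circumcenters -/

/-- The midpoint of two points is closer to a bounded set than these points. -/
theorem exists_midpoint {v w : ℂ × E} (hv : form v v = 1) (hw : form w w = 1) :
    ∃ m : ℂ × E, form m m = 1 ∧ ∀ s : ℂ × E,
      ‖form s m‖ ≤ (Real.sqrt (2 + 2 * ‖form v w‖))⁻¹ * (‖form s v‖ + ‖form s w‖) := by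
  obtain ⟨u, hu, huc⟩ := exists_norm_one_mul_eq_norm (form w v)
  have hwv : form (u • w) v = ‖form v w‖ := by rw [form_smul_left, huc, norm_form_comm]
  have hvw : form v (u • w) = ‖form v w‖ := by rw [← conj_form, hwv, Complex.conj_ofReal]
  have hz : form (v + u • w) (v + u • w) = ((2 + 2 * ‖form v w‖ : ℝ) : ℂ) := by
    rw [form_add_left, form_add_right, form_add_right, hv, hwv, hvw, form_self_smul, hu, hw]
    push_cast
    ring
  refine ⟨_, form_inv_sqrt_smul_self (by positivity) hz, fun s => ?_⟩
  rw [form_smul_right, norm_mul, RCLike.norm_conj, norm_inv, Complex.norm_real,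
    Real.norm_of_nonneg (Real.sqrt_nonneg _)]
  refine mul_le_mul_of_nonneg_left ?_ (by positivity)
  rw [form_add_right, form_smul_right]
  refine (norm_add_le _ _).trans (le_of_eq ?_)
  rw [norm_mul, RCLike.norm_conj, hu, one_mul]

/-- A bounded set of points of the hyperbolic space has a unique circumcenter: a minimizing
sequence for the radius is a Cauchy sequence, by comparison with midpoints. -/
theorem exists_circumcenter [CompleteSpace E] {S : Set (ℂ × E)} (hne : S.Nonempty)
    (hS : ∀ s ∈ S, form s s = 1) {C : ℝ} (hC : ∀ s ∈ S, ‖form s (basePt E)‖ ≤ C) :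
    ∃ (v : ℂ × E) (r : ℝ), form v v = 1 ∧ (∀ s ∈ S, ‖form s v‖ ≤ r) ∧
      ∀ w, form w w = 1 → (∀ s ∈ S, ‖form s w‖ ≤ r) → ‖form w v‖ = 1 := by
  obtain ⟨s₀, hs₀⟩ := hne
  set R : Set ℝ := {r | ∃ v : ℂ × E, form v v = 1 ∧ ∀ s ∈ S, ‖form s v‖ ≤ r} with hR
  have hRne : R.Nonempty := ⟨C, basePt E, form_basePt_self, hC⟩
  have hR1 : ∀ r ∈ R, 1 ≤ r := fun r ⟨v, hv, h⟩ =>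
    (one_le_norm_form (hS s₀ hs₀) hv).trans (h s₀ hs₀)
  have hRb : BddBelow R := ⟨1, hR1⟩
  set r₀ := sInf R with hr₀
  have hr₀1 : 1 ≤ r₀ := le_csInf hRne hR1
  have key : ∀ (v w : ℂ × E) (r : ℝ), form v v = 1 → form w w = 1 →
      (∀ s ∈ S, ‖form s v‖ ≤ r) → (∀ s ∈ S, ‖form s w‖ ≤ r) →
      r₀ ^ 2 * (2 + 2 * ‖form v w‖) ≤ (2 * r) ^ 2 := by
    intro v w r hv hw h1 h2
    obtain ⟨m, hm, hsm⟩ := exists_midpoint hv hw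
    have hp : 0 < 2 + 2 * ‖form v w‖ := by positivity
    have h3 : (Real.sqrt (2 + 2 * ‖form v w‖))⁻¹ * (r + r) ∈ R :=
      ⟨m, hm, fun s hs => (hsm s).trans
        (mul_le_mul_of_nonneg_left (add_le_add (h1 s hs) (h2 s hs)) (by positivity))⟩
    have h4 := csInf_le hRb h3
    rw [← hr₀, inv_mul_eq_div, le_div_iff₀ (Real.sqrt_pos.2 hp)] at h4
    have h5 := pow_le_pow_left₀ (by positivity) h4 2
    rw [mul_pow, Real.sq_sqrt hp.le] at h5
    linarith
  have hex : ∀ n : ℕ, ∃ v : ℂ × E, form v v = 1 ∧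
      ∀ s ∈ S, ‖form s v‖ ≤ r₀ + ((n : ℝ) + 1)⁻¹ := fun n => by
    obtain ⟨r, ⟨v, hv, h⟩, hr⟩ := exists_lt_of_csInf_lt hRne
      (show sInf R < r₀ + ((n : ℝ) + 1)⁻¹ by
        have : (0 : ℝ) < ((n : ℝ) + 1)⁻¹ := by positivity
        linarith)
    exact ⟨v, hv, fun s hs => (h s hs).trans hr.le⟩
  choose v hv hvS using hex
  have hlim0 : Tendsto (fun n : ℕ => ((n : ℝ) + 1)⁻¹) atTop (𝓝 0) := by
    simpa using tendsto_one_div_add_atTop_nhds_zero_nat (𝕜 := ℝ)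
  have hcau : CauchySeq fun n => ballPt (v n) := by
    refine cauchySeq_of_le_tendsto_0' (fun n : ℕ => Real.sqrt (12 * ((n : ℝ) + 1)⁻¹))
      (fun n m hnm => ?_) ?_
    · rw [dist_eq_norm]
      refine Real.le_sqrt_of_sq_le ((norm_ballPt_sub_sq_le (hv n) (hv m)).trans ?_)
      set ε := ((n : ℝ) + 1)⁻¹ with hε
      have hε0 : 0 < ε := by positivity
      have hε1 : ε ≤ 1 := inv_le_one_of_one_le₀ (by linarith [n.cast_nonneg (α := ℝ)])
      have hmn : ((m : ℝ) + 1)⁻¹ ≤ ε := by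
        rw [hε]
        gcongr
      have h1 := key (v n) (v m) (r₀ + ε) (hv n) (hv m) (hvS n)
        fun s hs => (hvS m s hs).trans (by linarith)
      have h2 : ‖form (v n) (v m)‖ ≤ 1 + 6 * ε := by
        by_contra! h
        have : r₀ ^ 2 * (2 + 2 * (1 + 6 * ε)) < r₀ ^ 2 * (2 + 2 * ‖form (v n) (v m)‖) := by
          gcongr
        nlinarith [mul_nonneg hε0.le (sub_nonneg.2 hr₀1), mul_nonneg hε0.le (sub_nonneg.2 hε1)]
      have h3 := inv_norm_fst_le_one (hv n)
      have h4 := inv_norm_fst_le_one (hv m)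
      set x := ‖(v n).1‖⁻¹
      set y := ‖(v m).1‖⁻¹
      have hx0 : 0 ≤ x := by positivity
      have hy0 : 0 ≤ y := by positivity
      have hxy : x * y ≤ 1 := mul_le_one₀ h3 hy0 h4
      have h5 : x * y * ‖form (v n) (v m)‖ ≤ x * y * (1 + 6 * ε) := by gcongr
      nlinarith [sq_nonneg (x - y)]
    · simpa using (hlim0.const_mul 12).sqrt
  obtain ⟨u, hu⟩ := cauchySeq_tendsto_of_complete hcau
  set y : ℂ × E := (1, u) with hy
  have hy0 : y ≠ 0 := fun h => one_ne_zero (congrArg Prod.fst h)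
  have hylim : Tendsto (fun n => ((1 : ℂ), ballPt (v n))) atTop (𝓝 y) :=
    tendsto_const_nhds.prodMk_nhds hu
  have hβlim : Tendsto (fun n => ‖(v n).1‖⁻¹ ^ 2) atTop (𝓝 (1 - ‖u‖ ^ 2)) := by
    have h1 := (tendsto_const_nhds (x := (1 : ℝ))).sub (hu.norm.pow 2)
    refine h1.congr fun n => ?_
    rw [norm_ballPt_sq (hv n)]
    ring
  set β := 1 - ‖u‖ ^ 2 with hβ
  have hβ0 : 0 ≤ β := ge_of_tendsto' hβlim fun n => by positivity
  have hyy : form y y = (β : ℂ) := by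
    rw [form_self]
    simp [hy, hβ]
  have hβlim' : Tendsto (fun n => ‖(v n).1‖⁻¹) atTop (𝓝 (Real.sqrt β)) := by
    refine (hβlim.sqrt).congr fun n => ?_
    rw [Real.sqrt_sq (by positivity)]
  have hyS : ∀ s ∈ S, ‖form s y‖ ≤ r₀ * Real.sqrt β := fun s hs => by
    have h1 : Tendsto (fun n => ‖form s ((1 : ℂ), ballPt (v n))‖) atTop (𝓝 ‖form s y‖) :=
      ((continuous_form.comp (continuous_const.prodMk continuous_id)).continuousAt.tendsto.comp
        hylim).norm
    have h2 : Tendsto (fun n : ℕ => (r₀ + ((n : ℝ) + 1)⁻¹) * ‖(v n).1‖⁻¹) atTop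
        (𝓝 (r₀ * Real.sqrt β)) := by
      simpa using (hlim0.const_add r₀).mul hβlim'
    refine le_of_tendsto_of_tendsto' h1 h2 fun n => ?_
    rw [← smul_eq_ballPt (hv n), form_smul_right, norm_mul, RCLike.norm_conj, norm_inv, mul_comm]
    exact mul_le_mul_of_nonneg_right (hvS n s hs) (by positivity)
  -- The limit is not on the boundary, since an isotropic vector is not orthogonal to `s₀`.
  have hβpos : 0 < β := by
    refine lt_of_le_of_ne hβ0 fun h => ?_
    have h1 : form y s₀ = 0 := by
      have := hyS s₀ hs₀
      rw [← h, Real.sqrt_zero, mul_zero, norm_form_comm] at this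
      exact norm_le_zero_iff.1 this
    have h2 := form_self_neg_of_orthogonal (by rw [hS s₀ hs₀]; simp) h1 hy0
    rw [hyy, ← h] at h2
    simp at h2
  refine ⟨((Real.sqrt β)⁻¹ : ℂ) • y, r₀, form_inv_sqrt_smul_self hβpos hyy, ?_, ?_⟩
  · intro s hs
    rw [form_smul_right, norm_mul, RCLike.norm_conj, norm_inv, Complex.norm_real,
      Real.norm_of_nonneg (Real.sqrt_nonneg _), inv_mul_le_iff₀ (Real.sqrt_pos.2 hβpos), mul_comm]
    exact hyS s hs
  · intro w hw hwS
    set z := ((Real.sqrt β)⁻¹ : ℂ) • y with hz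
    have hzz : form z z = 1 := form_inv_sqrt_smul_self hβpos hyy
    have h1 := key w z r₀ hw hzz hwS fun s hs => by
      rw [hz, form_smul_right, norm_mul, RCLike.norm_conj, norm_inv, Complex.norm_real,
        Real.norm_of_nonneg (Real.sqrt_nonneg _), inv_mul_le_iff₀ (Real.sqrt_pos.2 hβpos), mul_comm]
      exact hyS s hs
    refine le_antisymm ?_ (one_le_norm_form hw hzz)
    nlinarith [pow_pos (one_pos.trans_le hr₀1) 2]

/-- An isometry with a bounded orbit fixes a point of the hyperbolic space. -/
theorem exists_fixed_of_bounded [CompleteSpace E] (T : U E) {C : ℝ}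
    (hC : ∀ k : ℕ, ‖form ((T ^ k).1 (basePt E)) (basePt E)‖ ≤ C) :
    ∃ v : ℂ × E, form v v = 1 ∧ ∃ θ : ℂ, T.1 v = θ • v := by
  have hC' : ∀ s ∈ Set.range fun k : ℤ => (T ^ k).1 (basePt E), ‖form s (basePt E)‖ ≤ C := by
    rintro _ ⟨k, rfl⟩
    obtain ⟨n, rfl | rfl⟩ := k.eq_nat_or_neg
    · simpa using hC n
    · have := hC n
      rw [norm_form_comm, ← form_inv_left] at this
      simp only [zpow_neg, zpow_natCast]
      exact this
  obtain ⟨v, r, hv, hvS, huniq⟩ := exists_circumcenter (Set.range_nonempty _) (by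
    rintro _ ⟨k, rfl⟩
    rw [form_map, form_basePt_self]) hC'
  have h1 : form (T.1 v) (T.1 v) = 1 := by rw [form_map, hv]
  refine ⟨v, hv, _, eq_smul_of_norm_form_eq_one h1 hv (huniq _ h1 ?_)⟩
  rintro _ ⟨k, rfl⟩
  have := hvS _ ⟨k - 1, rfl⟩
  rw [← form_map T] at this
  simp only [← coe_mul_apply] at this
  rwa [← zpow_one_add, add_sub_cancel] at this

/-! ### Isometries with unbounded orbits -/

/-- If the orbit of an isometry `T` is unbounded, then a subsequence of `T ^ k x` converges to a
point of the boundary, which is fixed by all isometries that move the points `T ^ k x` by a bounded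
amount. The subsequence is that of the times at which the displacement is larger than ever
before. -/
theorem exists_limit_of_unbounded [CompleteSpace E] (T : U E)
    (hT : ∀ C : ℝ, ∃ k : ℕ, C < ‖form ((T ^ k).1 (basePt E)) (basePt E)‖) :
    ∃ y : ℂ × E, y ≠ 0 ∧ form y y = 0 ∧ ∀ h : U E,
      (∃ C : ℝ, ∀ᶠ k : ℕ in atTop,
        ‖form (h.1 ((T ^ k).1 (basePt E))) ((T ^ k).1 (basePt E))‖ ≤ C) →
      ∃ θ : ℂ, h.1 y = θ • y := by
  classical
  set c : ℕ → ℝ := fun k => ‖form ((T ^ k).1 (basePt E)) (basePt E)‖ with hc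
  let φ : ℕ → ℕ := fun n => Nat.find (hT (n + 1))
  have hφ1 : ∀ n : ℕ, (n : ℝ) + 1 < c (φ n) := fun n => Nat.find_spec (hT (n + 1))
  have hφ2 : ∀ n j, j ≤ φ n → c j ≤ c (φ n) := fun n j hj => by
    obtain rfl | hj := hj.eq_or_lt
    · exact le_rfl
    · exact (not_lt.1 (Nat.find_min (hT (n + 1)) hj)).trans (hφ1 n).le
  have hφmono : Monotone φ := fun n m hnm =>
    Nat.find_min' _ (lt_of_le_of_lt (by gcongr) (hφ1 m))
  have hφtop : Tendsto φ atTop atTop := by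
    refine hφmono.tendsto_atTop_atTop fun b => ?_
    obtain ⟨M, hM⟩ := (Set.finite_range fun i : Fin b => c i).bddAbove
    obtain ⟨n, hn⟩ := exists_nat_ge M
    refine ⟨n, ?_⟩
    by_contra! hlt
    have := hM ⟨⟨φ n, hlt⟩, rfl⟩
    have h2 := hφ1 n
    dsimp only at this
    linarith
  set v : ℕ → ℂ × E := fun n => (T ^ φ n).1 (basePt E) with hvdef
  have hv : ∀ n, form (v n) (v n) = 1 := fun n => by rw [hvdef, form_map, form_basePt_self]
  have hfst : ∀ n, ‖(v n).1‖ = c (φ n) := fun n => by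
    rw [hc, ← form_basePt_right]
  have hinv : ∀ n, ‖(v n).1‖⁻¹ ≤ ((n : ℝ) + 1)⁻¹ := fun n => by
    rw [hfst]
    exact inv_anti₀ (by positivity) (hφ1 n).le
  have hlim0 : Tendsto (fun n : ℕ => ((n : ℝ) + 1)⁻¹) atTop (𝓝 0) := by
    simpa using tendsto_one_div_add_atTop_nhds_zero_nat (𝕜 := ℝ)
  have hβlim : Tendsto (fun n => ‖(v n).1‖⁻¹) atTop (𝓝 0) :=
    squeeze_zero (fun n => by positivity) hinv hlim0
  have hcau : CauchySeq fun n => ballPt (v n) := by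
    refine cauchySeq_of_le_tendsto_0' (fun n : ℕ => Real.sqrt (2 * ((n : ℝ) + 1)⁻¹))
      (fun n m hnm => ?_) ?_
    · rw [dist_eq_norm]
      refine Real.le_sqrt_of_sq_le ((norm_ballPt_sub_sq_le (hv n) (hv m)).trans ?_)
      have h1 : ‖form (v n) (v m)‖ ≤ ‖(v m).1‖ := by
        have h2 : v m = (T ^ φ n).1 ((T ^ (φ m - φ n)).1 (basePt E)) := by
          rw [← coe_mul_apply, ← pow_add, Nat.add_sub_cancel' (hφmono hnm)]
        rw [h2, form_map, norm_form_comm, ← h2, hfst]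
        exact hφ2 m _ (Nat.sub_le _ _)
      have h3 : ‖(v n).1‖⁻¹ * ‖(v m).1‖⁻¹ * ‖form (v n) (v m)‖ ≤ ((n : ℝ) + 1)⁻¹ := by
        rw [mul_assoc]
        have h4 : ‖(v m).1‖⁻¹ * ‖form (v n) (v m)‖ ≤ 1 := by
          rw [inv_mul_le_iff₀ (one_pos.trans_le (one_le_norm_fst (hv m))), mul_one]
          exact h1
        calc _ ≤ ‖(v n).1‖⁻¹ * 1 := by gcongr
          _ ≤ _ := by rw [mul_one]; exact hinv n
      nlinarith [sq_nonneg ‖(v n).1‖⁻¹, sq_nonneg ‖(v m).1‖⁻¹]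
    · simpa using (hlim0.const_mul 2).sqrt
  obtain ⟨u, hu⟩ := cauchySeq_tendsto_of_complete hcau
  set y : ℂ × E := (1, u) with hy
  have hy0 : y ≠ 0 := fun h => one_ne_zero (congrArg Prod.fst h)
  have hylim : Tendsto (fun n => ((1 : ℂ), ballPt (v n))) atTop (𝓝 y) :=
    tendsto_const_nhds.prodMk_nhds hu
  have hyy : form y y = 0 := by
    have h1 : Tendsto (fun n => form ((1 : ℂ), ballPt (v n)) (1, ballPt (v n))) atTop
        (𝓝 (form y y)) :=
      (continuous_form.comp (continuous_id.prodMk continuous_id)).continuousAt.tendsto.comp hylim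
    refine tendsto_nhds_unique h1 ?_
    simp only [form_ballPt_self (hv _)]
    have h2 := (Complex.continuous_ofReal.tendsto _).comp (hβlim.pow 2)
    rw [zero_pow two_ne_zero, Complex.ofReal_zero] at h2
    exact h2
  refine ⟨y, hy0, hyy, fun h ⟨C, hC⟩ => ?_⟩
  refine exists_smul_eq_of_isotropic (by rw [form_map, hyy]) hyy ?_ hy0
  have h1 : Tendsto (fun n => form (h.1 ((1 : ℂ), ballPt (v n))) (1, ballPt (v n))) atTop
      (𝓝 (form (h.1 y) y)) :=
    (continuous_form.comp ((continuous_coe h).prodMk continuous_id)).continuousAt.tendsto.comp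
      hylim
  refine tendsto_nhds_unique h1 (squeeze_zero_norm' (a := fun n => ‖(v n).1‖⁻¹ ^ 2 * C) ?_ ?_)
  · filter_upwards [hφtop.eventually hC] with n hn
    rw [← smul_eq_ballPt (hv n), map_smul, form_smul_left, form_smul_right, norm_mul, norm_mul,
      RCLike.norm_conj, norm_inv, ← mul_assoc, ← sq]
    exact mul_le_mul_of_nonneg_left hn (by positivity)
  · simpa using (hβlim.pow 2).mul_const C

/-! ### Representations: contraction and fixed points -/

/-- The stabilizer of a line under a representation. -/
def Rep.stab (ρ : Rep E) (p : ℙ ℂ (ℂ × E)) : Subgroup (PU ℂ) where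
  carrier := {g | (ρ.hom g).1 p = p}
  one_mem' := by simp
  mul_mem' := fun {g h} hg hh => by
    rw [Set.mem_ofPred_eq] at *
    rw [map_mul, PU_mul_apply, hh, hg]
  inv_mem' := fun {g} hg => by
    rw [Set.mem_ofPred_eq] at *
    conv_lhs => rw [← hg, map_inv, PU_inv_apply]

theorem Rep.mem_stab {ρ : Rep E} {p : ℙ ℂ (ℂ × E)} {g : PU ℂ} :
    g ∈ ρ.stab p ↔ (ρ.hom g).1 p = p := Iff.rfl

theorem Rep.mem_stab_mk {ρ : Rep E} {v : ℂ × E} {hv : v ≠ 0} {g : PU ℂ} {T : U E}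
    (hT : proj T = ρ.hom g) : g ∈ ρ.stab (.mk ℂ v hv) ↔ ∃ θ : ℂ, T.1 v = θ • v := by
  rw [Rep.mem_stab, ← hT, proj_fixes_iff]

/-- Conjugating by the involution `weyl` moves the stabilizers. -/
theorem Rep.mem_stab_weyl {ρ : Rep E} {p : ℙ ℂ (ℂ × E)} {g : PU ℂ}
    (h : proj weyl * g * proj weyl ∈ ρ.stab p) : g ∈ ρ.stab ((ρ.hom (proj weyl)).1 p) := by
  rw [Rep.mem_stab] at *
  rw [← PU_mul_apply, ← map_mul]
  conv_rhs => rw [← h]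
  rw [← PU_mul_apply, ← map_mul, ← mul_assoc, ← mul_assoc, ← map_mul, weyl_mul_self, map_one,
    one_mul]

theorem Rep.diag_mem_stab_weyl {ρ : Rep E} {p : ℙ ℂ (ℂ × E)} {l : ℝ} (hl : 0 < l)
    (h : proj (borel l hl 0) ∈ ρ.stab p) :
    proj (borel l hl 0) ∈ ρ.stab ((ρ.hom (proj weyl)).1 p) := by
  refine Rep.mem_stab_weyl ?_
  have h1 : weyl * borel l hl 0 * weyl = (borel l hl 0)⁻¹ := by
    rw [weyl_mul_diag, mul_assoc, weyl_mul_self, mul_one, borel_inv]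
    exact borel_congr _ rfl neg_zero.symm
  rw [← map_mul, ← map_mul, h1, map_inv]
  exact (ρ.stab p).inv_mem h

theorem Rep.weyl_weyl_apply (ρ : Rep E) (p : ℙ ℂ (ℂ × E)) :
    (ρ.hom (proj weyl)).1 ((ρ.hom (proj weyl)).1 p) = p := by
  rw [← PU_mul_apply, ← map_mul, ← map_mul, weyl_mul_self, map_one, map_one]
  rfl

theorem Rep.tendsto_arcosh_norm_form (ρ : Rep E) {v : ℂ × E} (hv : form v v = 1) {ι : Type*}
    {f : Filter ι} {g : ι → PU ℂ} {g₀ : PU ℂ} (hg : Tendsto g f (𝓝 g₀)) {T : ι → U E} {T₀ : U E}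
    (hT : ∀ i, proj (T i) = ρ.hom (g i)) (hT₀ : proj T₀ = ρ.hom g₀) :
    Tendsto (fun i => Real.arcosh ‖form ((T i).1 v) (T₀.1 v)‖) f (𝓝 0) := by
  have hv0 : v ≠ 0 := (ne_zero_of_form_ne_zero (x := v) (y := v) (by rw [hv]; simp)).1
  have h1 := (ρ.continuous_orbit (.mk ℂ v hv0) ((mk_mem_space_iff v hv0).2 (by rw [hv]; simp))
    g₀).comp hg
  refine h1.congr fun i => ?_
  simp only [Function.comp]
  rw [← hT, ← hT₀, proj_mk, proj_mk, hdist_mk _ _ _ _ (by rw [form_map, hv])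
    (by rw [form_map, hv])]

theorem Rep.tendsto_norm_form (ρ : Rep E) {v : ℂ × E} (hv : form v v = 1) {ι : Type*}
    {f : Filter ι} {g : ι → PU ℂ} {g₀ : PU ℂ} (hg : Tendsto g f (𝓝 g₀)) {T : ι → U E} {T₀ : U E}
    (hT : ∀ i, proj (T i) = ρ.hom (g i)) (hT₀ : proj T₀ = ρ.hom g₀) :
    Tendsto (fun i => ‖form ((T i).1 v) (T₀.1 v)‖) f (𝓝 1) := by
  have h2 := (Real.continuous_cosh.tendsto 0).comp (ρ.tendsto_arcosh_norm_form hv hg hT hT₀)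
  rw [Real.cosh_zero] at h2
  refine h2.congr fun i => ?_
  exact Real.cosh_arcosh (one_le_norm_form (by rw [form_map, hv]) (by rw [form_map, hv]))

theorem tendsto_contract {l : ℝ} (hl : 0 < l) (b : ℝ) :
    Tendsto (fun k : ℕ => proj (borel l hl (b * (1 / 4) ^ k))) atTop
      (𝓝 (proj (borel l hl 0))) := by
  have h := continuous_proj_borel (X := ℝ) (l := fun _ => l) (b := id) (fun _ => hl)
    continuous_const continuous_id
  refine (h.tendsto 0).comp ?_
  have := tendsto_pow_atTop_nhds_zero_of_lt_one (r := (1 / 4 : ℝ)) (by norm_num) (by norm_num)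
  simpa using this.const_mul b

theorem Rep.proj_conj_pow (ρ : Rep E) {A N : U E} {l : ℝ} (hl : 0 < l) {b : ℝ}
    (hA : proj A = ρ.hom (proj (borel 2 two_pos 0)))
    (hN : proj N = ρ.hom (proj (borel l hl b))) (k : ℕ) :
    proj ((A ^ k)⁻¹ * N * A ^ k) = ρ.hom (proj (borel l hl (b * (1 / 4) ^ k))) := by
  rw [map_mul, map_mul, map_inv, map_pow, hA, hN, ← diag_pow_conj]
  simp only [map_mul, map_inv, map_pow]

theorem coe_pow_apply_of_eigen {A : U E} {v : ℂ × E} {θ : ℂ} (h : A.1 v = θ • v) (k : ℕ) :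
    (A ^ k).1 v = θ ^ k • v := by
  induction k with
  | zero => simp
  | succ k ih => rw [pow_succ, coe_mul_apply, h, map_smul, ih, smul_smul, pow_succ, mul_comm]

theorem norm_eq_one_of_eigen {A : U E} {v : ℂ × E} {θ : ℂ} (hv : form v v ≠ 0)
    (h : A.1 v = θ • v) : ‖θ‖ = 1 := by
  have h1 := form_map A v v
  rw [h, form_self_smul] at h1
  have h2 := mul_right_cancel₀ hv (h1.trans (one_mul _).symm)
  have h3 : ‖θ‖ ^ 2 = 1 := by exact_mod_cast h2
  exact (pow_eq_one_iff_of_nonneg (norm_nonneg θ) two_ne_zero).1 h3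

/-- The Mautner phenomenon: a point of the hyperbolic space fixed by `g(2, 0)` is fixed by the
unipotent elements, which conjugation by the inverse of `g(2, 0)` contracts. -/
theorem Rep.unip_mem_stab_of_diag (ρ : Rep E) {v : ℂ × E} (hv : form v v = 1) (hv0 : v ≠ 0)
    (h : proj (borel 2 two_pos 0) ∈ ρ.stab (.mk ℂ v hv0)) (b : ℝ) :
    proj (borel 1 one_pos b) ∈ ρ.stab (.mk ℂ v hv0) := by
  obtain ⟨A, hA⟩ := exists_proj_eq (ρ.hom (proj (borel 2 two_pos 0)))
  obtain ⟨N, hN⟩ := exists_proj_eq (ρ.hom (proj (borel 1 one_pos b)))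
  obtain ⟨θ, hθ⟩ := (Rep.mem_stab_mk hA).1 h
  have hθ1 := norm_eq_one_of_eigen (by rw [hv]; exact one_ne_zero) hθ
  have h1 := ρ.tendsto_norm_form hv (tendsto_contract one_pos b) (T₀ := 1)
    (ρ.proj_conj_pow one_pos hA hN) (by rw [borel_one_zero, map_one, map_one, map_one])
  have h2 : ∀ k : ℕ, ‖form (((A ^ k)⁻¹ * N * A ^ k).1 v) ((1 : U E).1 v)‖ = ‖form (N.1 v) v‖ :=
    fun k => by
      rw [coe_mul_apply, coe_mul_apply, form_inv_left]
      change ‖form _ ((A ^ k).1 v)‖ = _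
      rw [coe_pow_apply_of_eigen hθ, map_smul, form_smul_left, form_smul_right, norm_mul,
        norm_mul, RCLike.norm_conj, norm_pow, hθ1, one_pow, one_mul, one_mul]
  simp only [h2] at h1
  have h3 := tendsto_nhds_unique h1 tendsto_const_nhds
  exact (Rep.mem_stab_mk hN).2
    ⟨_, eq_smul_of_norm_form_eq_one (by rw [form_map, hv]) hv h3.symm⟩

theorem Rep.NonElementary.stab_ne_top {ρ : Rep E} (hρ : ρ.NonElementary) {v : ℂ × E} (hv0 : v ≠ 0)
    (hv : 0 ≤ (form v v).re) : ρ.stab (.mk ℂ v hv0) ≠ ⊤ := by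
  intro h
  refine hρ.1 ⟨.mk ℂ v hv0, ?_, fun g => Rep.mem_stab.1 (h ▸ Subgroup.mem_top g)⟩
  obtain h1 | h1 := hv.eq_or_lt
  · right
    rw [mk_mem_boundary_iff, form_self_eq_re, ← h1, Complex.ofReal_zero]
  · exact Or.inl ((mk_mem_space_iff v hv0).2 h1)

theorem Rep.NonElementary.diag_notMem_stab {ρ : Rep E} (hρ : ρ.NonElementary) {v : ℂ × E}
    (hv : form v v = 1) (hv0 : v ≠ 0) :
    proj (borel 2 two_pos 0) ∉ ρ.stab (.mk ℂ v hv0) := by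
  intro h
  refine hρ.stab_ne_top hv0 (by rw [hv]; simp) (eq_top_of_unipotent
    (ρ.unip_mem_stab_of_diag hv hv0 h) fun b => ?_)
  obtain ⟨W, hW⟩ := exists_proj_eq (ρ.hom (proj weyl))
  have h2 := Rep.diag_mem_stab_weyl two_pos h
  rw [← hW, proj_mk] at h2
  have h3 := ρ.unip_mem_stab_of_diag (by rw [form_map, hv]) _ h2 b
  rw [← proj_mk W v hv0, hW] at h3
  have h4 := Rep.mem_stab_weyl (p := (ρ.hom (proj weyl)).1 (.mk ℂ v hv0))
    (g := proj weyl * proj (borel 1 one_pos b) * proj weyl) (by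
      have : proj weyl * proj weyl = 1 := by rw [← map_mul, weyl_mul_self, map_one]
      rwa [show proj weyl * (proj weyl * proj (borel 1 one_pos b) * proj weyl) * proj weyl
        = (proj weyl * proj weyl) * proj (borel 1 one_pos b) * (proj weyl * proj weyl) by group,
        this, one_mul, mul_one])
  rwa [Rep.weyl_weyl_apply] at h4

/-- If `ρ` has no fixed point, then the orbits of `ρ(g(2, 0))` are unbounded and accumulate at a
boundary point that is fixed by the group of all `ρ(g(l, b))`. -/
theorem Rep.NonElementary.exists_fixed_isotropic [CompleteSpace E] {ρ : Rep E}
    (hρ : ρ.NonElementary) : ∃ (y : ℂ × E) (hy : y ≠ 0), form y y = 0 ∧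
      ∀ (l : ℝ) (hl : 0 < l) (b : ℝ), proj (borel l hl b) ∈ ρ.stab (.mk ℂ y hy) := by
  obtain ⟨A, hA⟩ := exists_proj_eq (ρ.hom (proj (borel 2 two_pos 0)))
  have hunb : ∀ C : ℝ, ∃ k : ℕ, C < ‖form ((A ^ k).1 (basePt E)) (basePt E)‖ := by
    by_contra! h
    obtain ⟨C, hC⟩ := h
    obtain ⟨v, hv, hθ⟩ := exists_fixed_of_bounded A hC
    have hv0 : v ≠ 0 := (ne_zero_of_form_ne_zero (x := v) (y := v) (by rw [hv]; simp)).1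
    exact hρ.diag_notMem_stab hv hv0 ((Rep.mem_stab_mk hA).2 hθ)
  obtain ⟨y, hy0, hyy, hy⟩ := exists_limit_of_unbounded A hunb
  refine ⟨y, hy0, hyy, fun l hl b => ?_⟩
  have hconj : ∀ (h : U E) (k : ℕ), ‖form (h.1 ((A ^ k).1 (basePt E))) ((A ^ k).1 (basePt E))‖
      = ‖form (((A ^ k)⁻¹ * h * A ^ k).1 (basePt E)) (basePt E)‖ := fun h k => by
    rw [coe_mul_apply, coe_mul_apply, form_inv_left]
  have hN : ∀ b : ℝ, proj (borel 1 one_pos b) ∈ ρ.stab (.mk ℂ y hy0) := fun b => by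
    obtain ⟨N, hN⟩ := exists_proj_eq (ρ.hom (proj (borel 1 one_pos b)))
    refine (Rep.mem_stab_mk hN).2 (hy N ⟨2, ?_⟩)
    have h1 := ρ.tendsto_norm_form form_basePt_self (tendsto_contract one_pos b) (T₀ := 1)
      (ρ.proj_conj_pow one_pos hA hN) (by rw [borel_one_zero, map_one, map_one, map_one])
    filter_upwards [h1.eventually_le_const one_lt_two] with k hk
    rw [hconj]
    exact hk
  have hD : proj (borel l hl 0) ∈ ρ.stab (.mk ℂ y hy0) := by
    obtain ⟨D, hD⟩ := exists_proj_eq (ρ.hom (proj (borel l hl 0)))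
    refine (Rep.mem_stab_mk hD).2 (hy D ⟨‖form (D.1 (basePt E)) (basePt E)‖, ?_⟩)
    refine Eventually.of_forall fun k => ?_
    obtain ⟨c, hc, h⟩ := eq_smul_of_proj_eq (S := (A ^ k)⁻¹ * D * A ^ k) (T := D) (by
      rw [ρ.proj_conj_pow hl hA hD, zero_mul, hD])
    rw [hconj, h, form_smul_left, norm_mul, hc, one_mul]
  rw [borel_eq_unip_mul_diag, map_mul]
  exact (ρ.stab _).mul_mem (hN _) hD

/-! ### Axis pairs -/

theorem Rep.NonElementary.exists_isAxisPair [CompleteSpace E] {ρ : Rep E}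
    (hρ : ρ.NonElementary) : ∃ η₁ η₂, ρ.IsAxisPair η₁ η₂ := by
  obtain ⟨y, hy0, hyy, hy⟩ := hρ.exists_fixed_isotropic
  obtain ⟨W, hW⟩ := exists_proj_eq (ρ.hom (proj weyl))
  have hWW : form (W.1 y) (W.1 y) = 0 := by rw [form_map, hyy]
  have hβ : form y (W.1 y) ≠ 0 := by
    intro h
    refine hρ.stab_ne_top hy0 (by rw [hyy]; simp) (eq_top_of_borel_weyl hy ?_)
    exact (Rep.mem_stab_mk hW).2
      (exists_smul_eq_of_isotropic hWW hyy (by rw [← conj_form, h, map_zero]) hy0)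
  set β := form y (W.1 y)
  refine ⟨y, (conj β)⁻¹ • W.1 y, hyy, by rw [form_self_smul, hWW, mul_zero], ?_,
    fun l hl b T hT => (Rep.mem_stab_mk hT).1 (hy l hl b), fun l hl T hT => ?_⟩
  · rw [form_smul_right, map_inv₀, Complex.conj_conj]
    exact inv_mul_cancel₀ hβ
  · have h := Rep.diag_mem_stab_weyl hl (hy l hl 0)
    rw [← hW, proj_mk] at h
    obtain ⟨θ, hθ⟩ := (Rep.mem_stab_mk hT).1 h
    exact ⟨θ, by rw [map_smul, hθ, smul_comm]⟩

variable {ρ : Rep E} {η₁ η₂ : ℂ × E}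

theorem Rep.IsAxisPair.form_swap (h : ρ.IsAxisPair η₁ η₂) : form η₂ η₁ = 1 := by
  rw [← conj_form, h.normalized, map_one]

theorem Rep.IsAxisPair.ne_zero (h : ρ.IsAxisPair η₁ η₂) : η₁ ≠ 0 ∧ η₂ ≠ 0 :=
  ne_zero_of_form_ne_zero (by rw [h.normalized]; exact one_ne_zero)

theorem Rep.IsAxisPair.map_eta₁ (h : ρ.IsAxisPair η₁ η₂) {l : ℝ} {hl : 0 < l} {b : ℝ}
    {T : U E} (hT : proj T = ρ.hom (proj (borel l hl b))) : T.1 η₁ = form (T.1 η₁) η₂ • η₁ := by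
  obtain ⟨θ, hθ⟩ := h.fixed₁ l hl b T hT
  rw [hθ, form_smul_left, h.normalized, mul_one]

theorem Rep.IsAxisPair.form_map_ne_zero (h : ρ.IsAxisPair η₁ η₂) {l : ℝ} {hl : 0 < l} {b : ℝ}
    {T : U E} (hT : proj T = ρ.hom (proj (borel l hl b))) : form (T.1 η₁) η₂ ≠ 0 := by
  intro h0
  have h1 := h.map_eta₁ hT
  rw [h0, zero_smul] at h1
  exact map_ne_zero' T h.ne_zero.1 h1

/-! ### The linear representation of the Borel subgroup -/

theorem Rep.IsAxisPair.exists_normalizedLift (h : ρ.IsAxisPair η₁ η₂) {l : ℝ} (hl : 0 < l)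
    (b : ℝ) : ∃ T : U E, ρ.IsNormalizedLift η₁ η₂ l hl b T := by
  obtain ⟨S, hS⟩ := exists_proj_eq (ρ.hom (proj (borel l hl b)))
  obtain ⟨u, hu, huc⟩ := exists_norm_one_mul_eq_norm (form (S.1 η₁) η₂)
  refine ⟨phase u hu * S, ?_, ‖form (S.1 η₁) η₂‖, norm_pos_iff.2 (h.form_map_ne_zero hS), ?_⟩
  · rw [← hS]
    exact proj_eq_of_eq_smul (c := u) fun v => rfl
  · rw [coe_mul_apply, phase_apply, form_smul_left, huc]

theorem Rep.IsNormalizedLift.unique {l : ℝ} {hl : 0 < l} {b : ℝ} {S T : U E}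
    (hS : ρ.IsNormalizedLift η₁ η₂ l hl b S) (hT : ρ.IsNormalizedLift η₁ η₂ l hl b T) :
    S = T := by
  obtain ⟨c, hc, hST⟩ := eq_smul_of_proj_eq (hS.1.trans hT.1.symm)
  obtain ⟨r, hr, hSr⟩ := hS.2
  obtain ⟨s, hs, hTs⟩ := hT.2
  rw [hST, form_smul_left, hTs] at hSr
  have h1 : c = 1 := by
    have hs' : (s : ℂ) ≠ 0 := by exact_mod_cast hs.ne'
    have h2 := congrArg norm hSr
    rw [norm_mul, hc, one_mul, Complex.norm_real, Complex.norm_real, Real.norm_of_nonneg hr.le,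
      Real.norm_of_nonneg hs.le] at h2
    rw [← h2] at hSr
    exact mul_right_cancel₀ hs' (hSr.trans (one_mul _).symm)
  apply Subtype.ext
  ext1 v
  rw [hST, h1, one_smul]

/-- The normalized linear representative of `ρ(g(l, b))`. -/
noncomputable def Rep.IsAxisPair.lift (h : ρ.IsAxisPair η₁ η₂) {l : ℝ} (hl : 0 < l) (b : ℝ) :
    U E := (h.exists_normalizedLift hl b).choose

theorem Rep.IsAxisPair.lift_spec (h : ρ.IsAxisPair η₁ η₂) {l : ℝ} (hl : 0 < l) (b : ℝ) :
    ρ.IsNormalizedLift η₁ η₂ l hl b (h.lift hl b) := (h.exists_normalizedLift hl b).choose_spec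

theorem Rep.IsAxisPair.proj_lift (h : ρ.IsAxisPair η₁ η₂) {l : ℝ} (hl : 0 < l) (b : ℝ) :
    proj (h.lift hl b) = ρ.hom (proj (borel l hl b)) := (h.lift_spec hl b).1

/-- The positive character by which the normalized representatives act on `η₁`. -/
noncomputable def Rep.IsAxisPair.char (h : ρ.IsAxisPair η₁ η₂) {l : ℝ} (hl : 0 < l) (b : ℝ) :
    ℝ := (form ((h.lift hl b).1 η₁) η₂).re

theorem Rep.IsAxisPair.form_lift_eta₁ (h : ρ.IsAxisPair η₁ η₂) {l : ℝ} (hl : 0 < l) (b : ℝ) :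
    form ((h.lift hl b).1 η₁) η₂ = h.char hl b := by
  obtain ⟨r, -, hr⟩ := (h.lift_spec hl b).2
  rw [Rep.IsAxisPair.char, hr, Complex.ofReal_re]

theorem Rep.IsAxisPair.char_pos (h : ρ.IsAxisPair η₁ η₂) {l : ℝ} (hl : 0 < l) (b : ℝ) :
    0 < h.char hl b := by
  obtain ⟨r, hr0, hr⟩ := (h.lift_spec hl b).2
  rwa [Rep.IsAxisPair.char, hr, Complex.ofReal_re]

theorem Rep.IsAxisPair.lift_eta₁ (h : ρ.IsAxisPair η₁ η₂) {l : ℝ} (hl : 0 < l) (b : ℝ) :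
    (h.lift hl b).1 η₁ = (h.char hl b : ℂ) • η₁ := by
  rw [← h.form_lift_eta₁, ← h.map_eta₁ (h.proj_lift hl b)]

theorem Rep.IsAxisPair.lift_congr (h : ρ.IsAxisPair η₁ η₂) {l l' b b' : ℝ} (hl : 0 < l)
    (hl' : 0 < l') (e : l = l') (e' : b = b') : h.lift hl b = h.lift hl' b' := by
  subst e e'
  rfl

theorem Rep.IsAxisPair.char_congr (h : ρ.IsAxisPair η₁ η₂) {l l' b b' : ℝ} (hl : 0 < l)
    (hl' : 0 < l') (e : l = l') (e' : b = b') : h.char hl b = h.char hl' b' := by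
  subst e e'
  rfl

theorem Rep.IsAxisPair.lift_mul (h : ρ.IsAxisPair η₁ η₂) {l l' : ℝ} (hl : 0 < l) (hl' : 0 < l')
    (b b' : ℝ) :
    h.lift hl b * h.lift hl' b' = h.lift (mul_pos hl hl') (l * b' + b / l') := by
  refine Rep.IsNormalizedLift.unique (ρ := ρ) ⟨?_, h.char hl b * h.char hl' b',
    mul_pos (h.char_pos _ _) (h.char_pos _ _), ?_⟩ (h.lift_spec _ _)
  · rw [map_mul, h.proj_lift, h.proj_lift, ← map_mul, ← map_mul, borel_mul]
  · rw [coe_mul_apply, h.lift_eta₁, map_smul, h.lift_eta₁, form_smul_left, form_smul_left,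
      h.normalized]
    push_cast
    ring

theorem Rep.IsAxisPair.char_mul (h : ρ.IsAxisPair η₁ η₂) {l l' : ℝ} (hl : 0 < l) (hl' : 0 < l')
    (b b' : ℝ) :
    h.char hl b * h.char hl' b' = h.char (mul_pos hl hl') (l * b' + b / l') := by
  have h1 := h.form_lift_eta₁ (mul_pos hl hl') (l * b' + b / l')
  rw [← h.lift_mul hl hl', coe_mul_apply, h.lift_eta₁, map_smul, h.lift_eta₁, form_smul_left,
    form_smul_left, h.normalized] at h1
  have h2 : ((h.char hl b * h.char hl' b' : ℝ) : ℂ)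
      = h.char (mul_pos hl hl') (l * b' + b / l') := by
    rw [← h1]
    push_cast
    ring
  exact_mod_cast h2

theorem Rep.IsAxisPair.lift_unip_mul (h : ρ.IsAxisPair η₁ η₂) (b b' : ℝ) :
    h.lift one_pos b * h.lift one_pos b' = h.lift one_pos (b + b') := by
  rw [h.lift_mul]
  exact h.lift_congr _ _ (one_mul 1) (by ring)

/-- The relation between `g(l, 0)` and `g(1, b)`. -/
theorem Rep.IsAxisPair.lift_diag_mul_unip (h : ρ.IsAxisPair η₁ η₂) {l : ℝ} (hl : 0 < l) (b : ℝ) :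
    h.lift hl 0 * h.lift one_pos b = h.lift one_pos (l ^ 2 * b) * h.lift hl 0 := by
  rw [h.lift_mul, h.lift_mul]
  refine h.lift_congr _ _ (by ring) ?_
  field_simp
  ring

/-- The unipotent elements fix `η₁`: the character is invariant under conjugation by `g(2, 0)`,
which multiplies the parameter of the unipotent group by `4`. -/
theorem Rep.IsAxisPair.char_unip (h : ρ.IsAxisPair η₁ η₂) (b : ℝ) : h.char one_pos b = 1 := by
  have hadd : ∀ b b', h.char one_pos b * h.char one_pos b' = h.char one_pos (b + b') := by
    intro b b'
    rw [h.char_mul]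
    exact h.char_congr _ _ (one_mul 1) (by ring)
  have h1 : h.char two_pos 0 * h.char one_pos b = h.char one_pos (4 * b) * h.char two_pos 0 := by
    rw [h.char_mul, h.char_mul]
    exact h.char_congr _ _ (by ring) (by ring)
  have h2 : h.char one_pos (4 * b) = h.char one_pos b ^ 4 := by
    rw [show 4 * b = (b + b) + (b + b) by ring, ← hadd, ← hadd]
    ring
  have h3 := h.char_pos two_pos 0
  have h4 := h.char_pos one_pos b
  have h5 : h.char one_pos b = h.char one_pos b ^ 4 := by
    rw [h2, mul_comm] at h1
    exact mul_right_cancel₀ h3.ne' h1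
  have h6 : h.char one_pos b ^ 3 = 1 := by
    refine mul_left_cancel₀ h4.ne' ?_
    rw [mul_one]
    nth_rewrite 3 [h5]
    ring
  exact (pow_eq_one_iff_of_nonneg h4.le three_ne_zero).1 h6

theorem Rep.IsAxisPair.lift_unip_eta₁ (h : ρ.IsAxisPair η₁ η₂) (b : ℝ) :
    (h.lift one_pos b).1 η₁ = η₁ := by
  rw [h.lift_eta₁, h.char_unip, Complex.ofReal_one, one_smul]

theorem Rep.IsAxisPair.lift_diag_eta₂ (h : ρ.IsAxisPair η₁ η₂) {l : ℝ} (hl : 0 < l) :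
    (h.lift hl 0).1 η₂ = (h.char hl 0 : ℂ)⁻¹ • η₂ := by
  obtain ⟨θ, hθ⟩ := h.fixed₂ l hl _ (h.proj_lift hl 0)
  have h1 := form_map (h.lift hl 0) η₂ η₁
  rw [hθ, h.lift_eta₁, form_smul_left, form_smul_right, h.form_swap, Complex.conj_ofReal,
    mul_one] at h1
  rw [hθ, eq_inv_of_mul_eq_one_left h1]

theorem Rep.IsAxisPair.form_add_self (h : ρ.IsAxisPair η₁ η₂) :
    form (η₁ + η₂) (η₁ + η₂) = ((2 : ℝ) : ℂ) := by
  rw [form_add_left, form_add_right, form_add_right, h.isotropic₁, h.isotropic₂, h.normalized,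
    h.form_swap]
  norm_num

/-- Along the axis, the displacement of `g(l, 0)` is the logarithm of its eigenvalue. -/
theorem Rep.IsAxisPair.arcosh_form_diag (h : ρ.IsAxisPair η₁ η₂) {l : ℝ} (hl : 0 < l) :
    Real.arcosh ‖form ((h.lift hl 0).1 (((Real.sqrt 2)⁻¹ : ℂ) • (η₁ + η₂)))
      (((Real.sqrt 2)⁻¹ : ℂ) • (η₁ + η₂))‖ = |Real.log (h.char hl 0)| := by
  have hc := h.char_pos hl 0
  have h2 : form ((h.lift hl 0).1 (η₁ + η₂)) (η₁ + η₂)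
      = ((h.char hl 0 + (h.char hl 0)⁻¹ : ℝ) : ℂ) := by
    rw [map_add, h.lift_eta₁, h.lift_diag_eta₂, form_add_left, form_smul_left, form_smul_left,
      form_add_right, form_add_right, h.isotropic₁, h.isotropic₂, h.normalized, h.form_swap]
    push_cast
    ring
  have h3 : ‖form ((h.lift hl 0).1 (((Real.sqrt 2)⁻¹ : ℂ) • (η₁ + η₂)))
      (((Real.sqrt 2)⁻¹ : ℂ) • (η₁ + η₂))‖ = Real.cosh |Real.log (h.char hl 0)| := by
    rw [Real.cosh_abs, Real.cosh_log hc, map_smul, form_smul_left, form_smul_right, h2, norm_mul,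
      norm_mul, RCLike.norm_conj, norm_inv, Complex.norm_real, Complex.norm_real,
      Real.norm_of_nonneg (Real.sqrt_nonneg _), Real.norm_of_nonneg (by positivity), ← mul_assoc,
      ← mul_inv, Real.mul_self_sqrt two_pos.le]
    ring
  rw [h3, Real.arcosh_cosh (abs_nonneg _)]

/-- The character is a power of `l`, as it is continuous by the continuity of the orbit of a point
of the axis. -/
theorem Rep.IsAxisPair.exists_char_eq_rpow (h : ρ.IsAxisPair η₁ η₂) :
    ∃ t : ℝ, ∀ (l : ℝ) (hl : 0 < l), h.char hl 0 = l ^ t := by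
  let f : ℝ →+ ℝ :=
    { toFun := fun s => Real.log (h.char (Real.exp_pos s) 0)
      map_zero' := by
        rw [h.char_congr _ one_pos Real.exp_zero rfl, h.char_unip, Real.log_one]
      map_add' := fun s s' => by
        rw [← Real.log_mul (h.char_pos _ _).ne' (h.char_pos _ _).ne', h.char_mul]
        congr 1
        exact h.char_congr _ _ (Real.exp_add s s') (by simp) }
  have hf : ∀ s, f s = Real.log (h.char (Real.exp_pos s) 0) := fun _ => rfl
  have hcont : Continuous f := by
    refine continuous_of_continuousAt_zero f ?_
    have hg : Tendsto (fun s : ℝ => proj (borel (Real.exp s) (Real.exp_pos s) 0)) (𝓝 0)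
        (𝓝 (1 : PU ℂ)) := by
      have h1 := (continuous_proj_borel (X := ℝ) (b := fun _ => 0) Real.exp_pos Real.continuous_exp
        continuous_const).tendsto 0
      have h2 : borel (Real.exp 0) (Real.exp_pos 0) 0 = 1 := by
        rw [← borel_one_zero]
        exact borel_congr _ Real.exp_zero rfl
      rwa [h2, map_one] at h1
    have h3 := ρ.tendsto_arcosh_norm_form (form_inv_sqrt_smul_self two_pos h.form_add_self) hg
      (T := fun s => h.lift (Real.exp_pos s) 0) (T₀ := 1) (fun s => h.proj_lift _ _)
      (by rw [map_one, map_one])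
    rw [ContinuousAt, map_zero]
    refine (tendsto_zero_iff_abs_tendsto_zero _).2 (h3.congr fun s => ?_)
    exact h.arcosh_form_diag _
  refine ⟨f 1, fun l hl => ?_⟩
  have h1 := map_real_smul f hcont (Real.log l) 1
  rw [smul_eq_mul, mul_one, hf, smul_eq_mul] at h1
  rw [h.char_congr (Real.exp_pos (Real.log l)) hl (Real.exp_log hl) rfl] at h1
  rw [Real.rpow_def_of_pos hl, ← h1, Real.exp_log (h.char_pos _ _)]

/-- The kernel `K(b) = B(ρ(g(1, b)) η₂, η₂)`. -/
noncomputable def Rep.IsAxisPair.kernel (h : ρ.IsAxisPair η₁ η₂) (b : ℝ) : ℂ :=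
  form ((h.lift one_pos b).1 η₂) η₂

theorem Rep.IsAxisPair.lift_unip_zero (h : ρ.IsAxisPair η₁ η₂) : h.lift one_pos 0 = 1 := by
  have h1 := h.lift_unip_mul 0 0
  rw [add_zero] at h1
  exact mul_eq_left.1 h1

theorem Rep.IsAxisPair.lift_unip_inv (h : ρ.IsAxisPair η₁ η₂) (b : ℝ) :
    (h.lift one_pos b)⁻¹ = h.lift one_pos (-b) := by
  refine inv_eq_of_mul_eq_one_left ?_
  rw [h.lift_unip_mul, neg_add_cancel, h.lift_unip_zero]

theorem Rep.IsAxisPair.kernel_neg (h : ρ.IsAxisPair η₁ η₂) (b : ℝ) :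
    h.kernel (-b) = conj (h.kernel b) := by
  rw [Rep.IsAxisPair.kernel, ← h.lift_unip_inv, form_inv_left, Rep.IsAxisPair.kernel, conj_form]

theorem Rep.IsAxisPair.kernel_zero (h : ρ.IsAxisPair η₁ η₂) : h.kernel 0 = 0 := by
  rw [Rep.IsAxisPair.kernel, h.lift_unip_zero]
  exact h.isotropic₂

theorem Rep.IsAxisPair.form_lift_lift (h : ρ.IsAxisPair η₁ η₂) (b b' : ℝ) :
    form ((h.lift one_pos b).1 η₂) ((h.lift one_pos b').1 η₂) = h.kernel (b - b') := by
  rw [← form_inv_left, h.lift_unip_inv, ← coe_mul_apply, h.lift_unip_mul, Rep.IsAxisPair.kernel,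
    neg_add_eq_sub]

theorem Rep.IsAxisPair.kernel_sq_mul (h : ρ.IsAxisPair η₁ η₂) {l : ℝ} (hl : 0 < l) (b : ℝ) :
    h.kernel (l ^ 2 * b) = (h.char hl 0 : ℂ) ^ 2 * h.kernel b := by
  have hc : (h.char hl 0 : ℂ) ≠ 0 := by exact_mod_cast (h.char_pos hl 0).ne'
  have h1 : ∀ x, form ((h.lift hl 0).1 x) η₂ = h.char hl 0 * form x η₂ := fun x => by
    rw [← form_map (h.lift hl 0) x η₂, h.lift_diag_eta₂, form_smul_right, map_inv₀,
      Complex.conj_ofReal, mul_inv_cancel_left₀ hc]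
  have h2 := h1 ((h.lift one_pos b).1 η₂)
  rw [← coe_mul_apply, h.lift_diag_mul_unip, coe_mul_apply, h.lift_diag_eta₂, map_smul,
    form_smul_left, inv_mul_eq_iff_eq_mul₀ hc] at h2
  rw [Rep.IsAxisPair.kernel, h2, Rep.IsAxisPair.kernel]
  ring

/-- The kernel is determined by the displacement and by `K(1)`. -/
theorem Rep.IsAxisPair.kernel_eq (h : ρ.IsAxisPair η₁ η₂) {t : ℝ}
    (ht : ∀ (l : ℝ) (hl : 0 < l), h.char hl 0 = l ^ t) {b : ℝ} (hb : 0 < b) :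
    h.kernel b = ((b ^ t : ℝ) : ℂ) * h.kernel 1 := by
  have hs := Real.sqrt_pos.2 hb
  have h1 := h.kernel_sq_mul hs 1
  rw [Real.sq_sqrt hb.le, mul_one, ht] at h1
  rw [h1]
  congr 1
  rw [← Complex.ofReal_pow, sq, ← Real.mul_rpow hs.le hs.le, Real.mul_self_sqrt hb.le]

/-! ### Uniqueness of the axis pair -/

theorem Rep.IsAxisPair.borel_mem_stab (h : ρ.IsAxisPair η₁ η₂) {l : ℝ} (hl : 0 < l) (b : ℝ) :
    proj (borel l hl b) ∈ ρ.stab (.mk ℂ η₁ h.ne_zero.1) :=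
  (Rep.mem_stab_mk (h.proj_lift hl b)).2 ⟨_, h.lift_eta₁ hl b⟩

theorem Rep.IsAxisPair.diag_mem_stab (h : ρ.IsAxisPair η₁ η₂) {l : ℝ} (hl : 0 < l) :
    proj (borel l hl 0) ∈ ρ.stab (.mk ℂ η₂ h.ne_zero.2) :=
  (Rep.mem_stab_mk (h.proj_lift hl 0)).2 ⟨_, h.lift_diag_eta₂ hl⟩

theorem Rep.IsAxisPair.mk_ne_mk (h : ρ.IsAxisPair η₁ η₂) :
    Projectivization.mk ℂ η₁ h.ne_zero.1 ≠ .mk ℂ η₂ h.ne_zero.2 := by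
  rw [Ne, Projectivization.mk_eq_mk_iff']
  rintro ⟨a, ha⟩
  have := h.normalized
  rw [← ha, form_smul_left, h.isotropic₂, mul_zero] at this
  exact zero_ne_one this

/-- If the eigenvalue were trivial, the point `[η₁ + η₂]` would be fixed by `g(2, 0)`. -/
theorem Rep.IsAxisPair.char_two_ne_one (h : ρ.IsAxisPair η₁ η₂) (hρ : ρ.NonElementary) :
    h.char two_pos 0 ≠ 1 := by
  intro h1
  have hv := form_inv_sqrt_smul_self two_pos h.form_add_self
  have hv0 := (ne_zero_of_form_ne_zero (by rw [hv]; exact one_ne_zero)).1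
  refine hρ.diag_notMem_stab hv hv0 ((Rep.mem_stab_mk (h.proj_lift two_pos 0)).2 ⟨1, ?_⟩)
  rw [map_smul, map_add, h.lift_eta₁, h.lift_diag_eta₂, h1]
  simp

/-- The only isotropic lines fixed by `g(2, 0)` are the two ends of the axis. -/
theorem Rep.IsAxisPair.eq_of_diag_mem_stab (h : ρ.IsAxisPair η₁ η₂) (hρ : ρ.NonElementary)
    {p : ℙ ℂ (ℂ × E)} (hp : p ∈ boundary E) (hfix : proj (borel 2 two_pos 0) ∈ ρ.stab p) :
    p = .mk ℂ η₁ h.ne_zero.1 ∨ p = .mk ℂ η₂ h.ne_zero.2 := by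
  induction p using Projectivization.ind with
  | h z hz =>
    rw [mk_mem_boundary_iff] at hp
    obtain ⟨θ, hθ⟩ := (Rep.mem_stab_mk (h.proj_lift two_pos 0)).1 hfix
    have h1 := h.char_two_ne_one hρ
    have h0 := h.char_pos two_pos 0
    set χ := h.char two_pos 0 with hχ
    have e1 := form_map (h.lift two_pos 0) z η₁
    have e2 := form_map (h.lift two_pos 0) z η₂
    rw [hθ, h.lift_eta₁, form_smul_left, form_smul_right, Complex.conj_ofReal, ← hχ] at e1
    rw [hθ, h.lift_diag_eta₂, form_smul_left, form_smul_right, map_inv₀, Complex.conj_ofReal,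
      ← hχ] at e2
    by_cases hz1 : form z η₁ = 0
    · left
      obtain ⟨a, ha⟩ := exists_smul_eq_of_isotropic hp h.isotropic₁ hz1 h.ne_zero.1
      rw [Projectivization.mk_eq_mk_iff']
      exact ⟨a, ha.symm⟩
    by_cases hz2 : form z η₂ = 0
    · right
      obtain ⟨a, ha⟩ := exists_smul_eq_of_isotropic hp h.isotropic₂ hz2 h.ne_zero.2
      rw [Projectivization.mk_eq_mk_iff']
      exact ⟨a, ha.symm⟩
    exfalso
    rw [← mul_assoc] at e1 e2
    have e3 : θ * χ = 1 := mul_right_cancel₀ hz1 (e1.trans (one_mul _).symm)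
    have e4 : θ * (χ : ℂ)⁻¹ = 1 := mul_right_cancel₀ hz2 (e2.trans (one_mul _).symm)
    have hχ0 : (χ : ℂ) ≠ 0 := by exact_mod_cast h0.ne'
    have e5 : (χ : ℂ) ^ 2 = 1 := by
      have : θ = χ := by
        rw [← div_eq_mul_inv, div_eq_one_iff_eq hχ0] at e4
        exact e4
      rw [sq, ← e3, this]
    have e6 : χ ^ 2 = 1 := by exact_mod_cast e5
    exact h1 ((pow_eq_one_iff_of_nonneg h0.le two_ne_zero).1 e6)

theorem PU_apply_mem_boundary (g : PU E) {p : ℙ ℂ (ℂ × E)} (hp : p ∈ boundary E) :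
    g.1 p ∈ boundary E := by
  obtain ⟨T, rfl⟩ := exists_proj_eq g
  induction p using Projectivization.ind with
  | h v hv =>
    rw [mk_mem_boundary_iff] at hp
    rw [proj_mk, mk_mem_boundary_iff, form_map, hp]

theorem Rep.IsAxisPair.mem_boundary (h : ρ.IsAxisPair η₁ η₂) :
    Projectivization.mk ℂ η₁ h.ne_zero.1 ∈ boundary E ∧
      Projectivization.mk ℂ η₂ h.ne_zero.2 ∈ boundary E :=
  ⟨(mk_mem_boundary_iff _ _).2 h.isotropic₁, (mk_mem_boundary_iff _ _).2 h.isotropic₂⟩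

/-- The Weyl element exchanges the ends of the axis. -/
theorem Rep.IsAxisPair.weyl_apply (h : ρ.IsAxisPair η₁ η₂) (hρ : ρ.NonElementary) :
    (ρ.hom (proj weyl)).1 (.mk ℂ η₁ h.ne_zero.1) = .mk ℂ η₂ h.ne_zero.2 := by
  refine (h.eq_of_diag_mem_stab hρ (PU_apply_mem_boundary _ h.mem_boundary.1)
    (Rep.diag_mem_stab_weyl two_pos (h.borel_mem_stab two_pos 0))).resolve_left fun h1 => ?_
  exact hρ.stab_ne_top h.ne_zero.1 (by rw [h.isotropic₁]; simp)
    (eq_top_of_borel_weyl (fun l hl b => h.borel_mem_stab hl b) h1)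

theorem Rep.IsAxisPair.weyl_apply' (h : ρ.IsAxisPair η₁ η₂) (hρ : ρ.NonElementary) :
    (ρ.hom (proj weyl)).1 (.mk ℂ η₂ h.ne_zero.2) = .mk ℂ η₁ h.ne_zero.1 := by
  rw [← h.weyl_apply hρ, Rep.weyl_weyl_apply]

/-- The second end of the axis is not fixed by the unipotent group, since otherwise the pair of the
ends would be invariant. -/
theorem Rep.IsAxisPair.exists_unip_notMem_stab (h : ρ.IsAxisPair η₁ η₂) (hρ : ρ.NonElementary) :
    ∃ b : ℝ, proj (borel 1 one_pos b) ∉ ρ.stab (.mk ℂ η₂ h.ne_zero.2) := by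
  by_contra! hN
  have hP : ∀ (l : ℝ) (hl : 0 < l) (b : ℝ),
      proj (borel l hl b) ∈ ρ.stab (.mk ℂ η₂ h.ne_zero.2) := fun l hl b => by
    rw [borel_eq_unip_mul_diag, map_mul]
    exact (ρ.stab _).mul_mem (hN _) (h.diag_mem_stab hl)
  have hP1 := fun (l : ℝ) (hl : 0 < l) (b : ℝ) => Rep.mem_stab.1 (h.borel_mem_stab hl b)
  have hP2 := fun (l : ℝ) (hl : 0 < l) (b : ℝ) => Rep.mem_stab.1 (hP l hl b)
  refine hρ.2 ⟨_, h.mem_boundary.1, _, h.mem_boundary.2, h.mk_ne_mk, fun g => ?_⟩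
  obtain ⟨l, hl, b, rfl⟩ | ⟨s, l, hl, b, rfl⟩ := bruhat g
  · exact Or.inl ⟨hP1 l hl b, hP2 l hl b⟩
  · right
    simp only [map_mul, PU_mul_apply]
    rw [hP1, hP2, h.weyl_apply hρ, h.weyl_apply' hρ]
    exact ⟨hP2 _ _ _, hP1 _ _ _⟩

theorem Rep.IsAxisPair.kernel_ne_zero (h : ρ.IsAxisPair η₁ η₂) (hρ : ρ.NonElementary) {b : ℝ}
    (hb : b ≠ 0) : h.kernel b ≠ 0 := by
  obtain ⟨t, ht⟩ := h.exists_char_eq_rpow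
  have h1 : h.kernel 1 ≠ 0 := by
    intro h0
    have hpos : ∀ b : ℝ, 0 < b → h.kernel b = 0 := fun b hb => by
      rw [h.kernel_eq ht hb, h0, mul_zero]
    have hall : ∀ b : ℝ, h.kernel b = 0 := fun b => by
      obtain hb | rfl | hb := lt_trichotomy b 0
      · rw [← neg_neg b, h.kernel_neg, hpos _ (neg_pos.2 hb), map_zero]
      · exact h.kernel_zero
      · exact hpos b hb
    obtain ⟨b, hb⟩ := h.exists_unip_notMem_stab hρ
    exact hb ((Rep.mem_stab_mk (h.proj_lift one_pos b)).2 (exists_smul_eq_of_isotropic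
      (by rw [form_map, h.isotropic₂]) h.isotropic₂ (hall b) h.ne_zero.2))
  have hpos : ∀ b : ℝ, 0 < b → h.kernel b ≠ 0 := fun b hb => by
    rw [h.kernel_eq ht hb]
    exact mul_ne_zero (by exact_mod_cast (Real.rpow_pos_of_pos hb t).ne') h1
  obtain hb | hb := hb.lt_or_gt
  · rw [← neg_neg b, h.kernel_neg]
    exact (map_ne_zero _).2 (hpos _ (neg_pos.2 hb))
  · exact hpos b hb

/-- The axis pair is unique up to scaling. -/
theorem Rep.IsAxisPair.exists_eq_smul (h : ρ.IsAxisPair η₁ η₂) (hρ : ρ.NonElementary)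
    {ζ₁ ζ₂ : ℂ × E} (h' : ρ.IsAxisPair ζ₁ ζ₂) :
    ∃ c : ℂ, c ≠ 0 ∧ ζ₁ = c • η₁ ∧ ζ₂ = (conj c)⁻¹ • η₂ := by
  have h1 : Projectivization.mk ℂ ζ₁ h'.ne_zero.1 = .mk ℂ η₁ h.ne_zero.1 := by
    refine (h.eq_of_diag_mem_stab hρ h'.mem_boundary.1
      (h'.borel_mem_stab two_pos 0)).resolve_right fun h1 => ?_
    obtain ⟨b, hb⟩ := h.exists_unip_notMem_stab hρ
    exact hb (h1 ▸ h'.borel_mem_stab one_pos b)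
  have h2 : Projectivization.mk ℂ ζ₂ h'.ne_zero.2 = .mk ℂ η₂ h.ne_zero.2 := by
    refine (h.eq_of_diag_mem_stab hρ h'.mem_boundary.2
      (h'.diag_mem_stab two_pos)).resolve_left fun h2 => ?_
    exact h'.mk_ne_mk (h1.trans h2.symm)
  rw [Projectivization.mk_eq_mk_iff'] at h1 h2
  obtain ⟨c, rfl⟩ := h1
  obtain ⟨d, rfl⟩ := h2
  have h3 := h'.normalized
  rw [form_smul_left, form_smul_right, h.normalized, mul_one] at h3
  refine ⟨c, left_ne_zero_of_mul_eq_one h3, rfl, ?_⟩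
  have h4 : d * conj c = 1 := by
    have := congrArg conj h3
    rwa [map_mul, Complex.conj_conj, map_one, mul_comm] at this
  rw [eq_inv_of_mul_eq_one_left h4]

theorem Rep.IsAxisPair.smul (h : ρ.IsAxisPair η₁ η₂) {c : ℂ} (hc : c ≠ 0) :
    ρ.IsAxisPair (c • η₁) ((conj c)⁻¹ • η₂) where
  isotropic₁ := by rw [form_self_smul, h.isotropic₁, mul_zero]
  isotropic₂ := by rw [form_self_smul, h.isotropic₂, mul_zero]
  normalized := by
    rw [form_smul_left, form_smul_right, h.normalized, map_inv₀, Complex.conj_conj, mul_one]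
    exact mul_inv_cancel₀ hc
  fixed₁ l hl b T hT := by
    obtain ⟨θ, hθ⟩ := h.fixed₁ l hl b T hT
    exact ⟨θ, by rw [map_smul, hθ, smul_comm]⟩
  fixed₂ l hl T hT := by
    obtain ⟨θ, hθ⟩ := h.fixed₂ l hl T hT
    exact ⟨θ, by rw [map_smul, hθ, smul_comm]⟩

/-- Rescaling the axis pair does not change the normalized representatives. -/
theorem Rep.IsAxisPair.lift_smul (h : ρ.IsAxisPair η₁ η₂) {c : ℂ} (hc : c ≠ 0)
    (h' : ρ.IsAxisPair (c • η₁) ((conj c)⁻¹ • η₂)) {l : ℝ} (hl : 0 < l) (b : ℝ) :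
    h'.lift hl b = h.lift hl b := by
  refine (h'.lift_spec hl b).unique ⟨h.proj_lift hl b, h.char hl b, h.char_pos hl b, ?_⟩
  rw [map_smul, form_smul_left, form_smul_right, map_inv₀, Complex.conj_conj,
    mul_inv_cancel_left₀ hc, h.form_lift_eta₁]

theorem Rep.IsAxisPair.char_smul (h : ρ.IsAxisPair η₁ η₂) {c : ℂ} (hc : c ≠ 0)
    (h' : ρ.IsAxisPair (c • η₁) ((conj c)⁻¹ • η₂)) {l : ℝ} (hl : 0 < l) (b : ℝ) :
    h'.char hl b = h.char hl b := by
  rw [Rep.IsAxisPair.char, h.lift_smul hc, map_smul, form_smul_left, form_smul_right, map_inv₀,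
    Complex.conj_conj, mul_inv_cancel_left₀ hc, Rep.IsAxisPair.char]

theorem Rep.IsAxisPair.kernel_smul (h : ρ.IsAxisPair η₁ η₂) {c : ℂ} (hc : c ≠ 0)
    (h' : ρ.IsAxisPair (c • η₁) ((conj c)⁻¹ • η₂)) (b : ℝ) :
    h'.kernel b = ((‖c‖⁻¹ ^ 2 : ℝ) : ℂ) * h.kernel b := by
  rw [Rep.IsAxisPair.kernel, h.lift_smul hc, map_smul, form_smul_left, form_smul_right,
    ← mul_assoc, Complex.mul_conj, Complex.normSq_eq_norm_sq, norm_inv, RCLike.norm_conj,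
    Rep.IsAxisPair.kernel]

/-! ### The invariants -/

theorem Rep.IsAxisPair.hasDisplacement_iff (h : ρ.IsAxisPair η₁ η₂) (hρ : ρ.NonElementary)
    {t : ℝ} : ρ.HasDisplacement t ↔ ∀ (l : ℝ) (hl : 0 < l), h.char hl 0 = l ^ t := by
  constructor
  · rintro ⟨ζ₁, ζ₂, h', H⟩ l hl
    obtain ⟨c, hc, rfl, rfl⟩ := h.exists_eq_smul hρ h'
    have h1 := h'.form_lift_eta₁ hl 0
    rw [H l hl _ (h'.lift_spec hl 0), form_smul_left, h'.normalized, mul_one, h.char_smul hc] at h1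
    exact_mod_cast h1.symm
  · intro H
    refine ⟨η₁, η₂, h, fun l hl T hT => ?_⟩
    rw [hT.unique (h.lift_spec hl 0), h.lift_eta₁, H]

theorem Rep.IsAxisPair.hasAngle_iff (h : ρ.IsAxisPair η₁ η₂) (hρ : ρ.NonElementary)
    {θ : ℝ} : ρ.HasAngle θ ↔ θ = Complex.arg (h.kernel 1) := by
  constructor
  · rintro ⟨ζ₁, ζ₂, h', T, hT, rfl⟩
    obtain ⟨c, hc, rfl, rfl⟩ := h.exists_eq_smul hρ h'
    rw [hT.unique (h'.lift_spec one_pos 1)]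
    change Complex.arg (h'.kernel 1) = _
    rw [h.kernel_smul hc, Complex.arg_real_mul _ (by have := norm_pos_iff.2 hc; positivity)]
  · rintro rfl
    exact ⟨η₁, η₂, h, _, h.lift_spec one_pos 1, rfl⟩

theorem Rep.NonElementary.existsUnique_hasDisplacement [CompleteSpace E] (hρ : ρ.NonElementary) :
    ∃! t : ℝ, ρ.HasDisplacement t := by
  obtain ⟨η₁, η₂, h⟩ := hρ.exists_isAxisPair
  obtain ⟨t, ht⟩ := h.exists_char_eq_rpow
  refine ⟨t, (h.hasDisplacement_iff hρ).2 ht, fun s hs => ?_⟩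
  have h1 := (h.hasDisplacement_iff hρ).1 hs 2 two_pos
  rw [ht] at h1
  have h2 := congrArg Real.log h1
  rw [Real.log_rpow two_pos, Real.log_rpow two_pos] at h2
  exact (mul_right_cancel₀ (Real.log_pos one_lt_two).ne' h2).symm

theorem Rep.NonElementary.existsUnique_hasAngle [CompleteSpace E] (hρ : ρ.NonElementary) :
    ∃! θ : ℝ, ρ.HasAngle θ := by
  obtain ⟨η₁, η₂, h⟩ := hρ.exists_isAxisPair
  exact ⟨_, (h.hasAngle_iff hρ).2 rfl, fun s hs => (h.hasAngle_iff hρ).1 hs⟩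

theorem Rep.NonElementary.hasDisplacement [CompleteSpace E] (hρ : ρ.NonElementary) :
    ρ.HasDisplacement ρ.displacement :=
  Classical.epsilon_spec hρ.existsUnique_hasDisplacement.exists

theorem Rep.NonElementary.hasAngle [CompleteSpace E] (hρ : ρ.NonElementary) :
    ρ.HasAngle ρ.angle :=
  Classical.epsilon_spec hρ.existsUnique_hasAngle.exists

/-! ### Conjugate representations have the same invariants -/

theorem proj_conj_of_conj {ρ₁ ρ₂ : Rep E} {S : U E}
    (hS : ∀ g, ρ₂.hom g = proj S * ρ₁.hom g * (proj S)⁻¹) {g : PU ℂ} {T : U E}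
    (hT : proj T = ρ₂.hom g) : proj (S⁻¹ * T * S) = ρ₁.hom g := by
  rw [map_mul, map_mul, map_inv, hT, hS]
  group

theorem Rep.IsAxisPair.map {ρ₁ ρ₂ : Rep E} {S : U E}
    (hS : ∀ g, ρ₂.hom g = proj S * ρ₁.hom g * (proj S)⁻¹) {η₁ η₂ : ℂ × E}
    (h : ρ₁.IsAxisPair η₁ η₂) : ρ₂.IsAxisPair (S.1 η₁) (S.1 η₂) where
  isotropic₁ := by rw [form_map, h.isotropic₁]
  isotropic₂ := by rw [form_map, h.isotropic₂]
  normalized := by rw [form_map, h.normalized]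
  fixed₁ l hl b T hT := by
    obtain ⟨θ, hθ⟩ := h.fixed₁ l hl b _ (proj_conj_of_conj hS hT)
    refine ⟨θ, ?_⟩
    rw [← map_smul, ← hθ, ← coe_mul_apply, ← coe_mul_apply]
    congr 2
    group
  fixed₂ l hl T hT := by
    obtain ⟨θ, hθ⟩ := h.fixed₂ l hl _ (proj_conj_of_conj hS hT)
    refine ⟨θ, ?_⟩
    rw [← map_smul, ← hθ, ← coe_mul_apply, ← coe_mul_apply]
    congr 2
    group

theorem Rep.IsAxisPair.lift_map {ρ₁ ρ₂ : Rep E} {S : U E}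
    (hS : ∀ g, ρ₂.hom g = proj S * ρ₁.hom g * (proj S)⁻¹) {η₁ η₂ : ℂ × E}
    (h : ρ₁.IsAxisPair η₁ η₂) {l : ℝ} (hl : 0 < l) (b : ℝ) :
    h.lift hl b = S⁻¹ * (h.map hS).lift hl b * S := by
  refine (h.lift_spec hl b).unique ⟨proj_conj_of_conj hS ((h.map hS).proj_lift hl b), _,
    (h.map hS).char_pos hl b, ?_⟩
  rw [coe_mul_apply, coe_mul_apply, form_inv_left, (h.map hS).form_lift_eta₁]

theorem Rep.Conj.invariants_eq [CompleteSpace E] {ρ₁ ρ₂ : Rep E} (h₁ : ρ₁.NonElementary)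
    (h₂ : ρ₂.NonElementary) (h : ρ₁.Conj ρ₂) :
    ρ₁.displacement = ρ₂.displacement ∧ ρ₁.angle = ρ₂.angle := by
  obtain ⟨T, hS⟩ := h
  obtain ⟨S, rfl⟩ := exists_proj_eq T
  obtain ⟨η₁, η₂, h⟩ := h₁.exists_isAxisPair
  constructor
  · refine h₂.existsUnique_hasDisplacement.unique ?_ h₂.hasDisplacement
    have h3 := (h.hasDisplacement_iff h₁).1 h₁.hasDisplacement
    refine ((h.map hS).hasDisplacement_iff h₂).2 fun l hl => ?_
    rw [← h3 l hl, Rep.IsAxisPair.char, Rep.IsAxisPair.char, h.lift_map hS, coe_mul_apply,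
      coe_mul_apply, form_inv_left]
  · rw [(h.hasAngle_iff h₁).1 h₁.hasAngle, ((h.map hS).hasAngle_iff h₂).1 h₂.hasAngle,
      Rep.IsAxisPair.kernel, Rep.IsAxisPair.kernel, h.lift_map hS, coe_mul_apply,
      coe_mul_apply, form_inv_left]

/-! ### Families with the same Gram matrix -/

/-- In a Hilbert space, two maps of dense range that pull back the same norm differ by a unitary
operator. -/
theorem exists_linearIsometryEquiv {F : Type*} [NormedAddCommGroup F] [InnerProductSpace ℂ F]
    [CompleteSpace F] {M : Type*} [AddCommGroup M] [Module ℂ M] {f g : M →ₗ[ℂ] F}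
    (hf : DenseRange f) (hg : DenseRange g) (h : ∀ m, ‖f m‖ = ‖g m‖) :
    ∃ V : F ≃ₗᵢ[ℂ] F, ∀ m, V (f m) = g m := by
  have h1 : ∃ C, ∀ m, ‖g m‖ ≤ C * ‖f m‖ := ⟨1, fun m => by rw [one_mul, h]⟩
  let V₀ : F →L[ℂ] F := g.extendOfNorm f
  have hV : ∀ m, V₀ (f m) = g m := LinearMap.extendOfNorm_eq hf h1
  have hnorm : ∀ x, ‖V₀ x‖ = ‖x‖ := fun x => by
    refine hf.induction_on x (isClosed_eq (by fun_prop) (by fun_prop)) fun m => ?_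
    rw [hV, h]
  let V₁ : F →ₗᵢ[ℂ] F := ⟨V₀.toLinearMap, hnorm⟩
  have hsurj : Function.Surjective V₁ := by
    have h2 : IsClosed (Set.range V₁) := V₁.isometry.isClosedEmbedding.isClosed_range
    have h3 : Dense (Set.range V₁) := hg.mono (by
      rintro _ ⟨m, rfl⟩
      exact ⟨f m, hV m⟩)
    rw [← Set.range_eq_univ, ← h2.closure_eq, h3.closure_eq]
  exact ⟨LinearIsometryEquiv.ofSurjective V₁ hsurj, hV⟩

theorem denseRange_map [CompleteSpace E] (T : U E) {M : Type*} {f : M → ℂ × E} (hf : DenseRange f) :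
    DenseRange fun m => T.1 (f m) :=
  T.1.surjective.denseRange.comp hf (continuous_coe T)

/-- A unitary operator of `E`, acting on the second factor of `ℂ × E`. -/
def ofIsometryEquiv (V : E ≃ₗᵢ[ℂ] E) : U E :=
  ⟨(LinearEquiv.refl ℂ ℂ).prodCongr V.toLinearEquiv, fun x y => by
    change x.1 * conj y.1 - inner ℂ (V y.2) (V x.2) = _
    rw [V.inner_map_map, form]⟩

theorem ofIsometryEquiv_apply (V : E ≃ₗᵢ[ℂ] E) (v : ℂ × E) :
    (ofIsometryEquiv V).1 v = (v.1, V v.2) := rfl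

/-- Two maps of dense range that pull back the same Hermitian form differ by an element of the
unitary group, as soon as the image of one of them contains a positive vector. -/
theorem exists_unitary_of_form_eq [CompleteSpace E] {M : Type*} [AddCommGroup M] [Module ℂ M]
    {f g : M →ₗ[ℂ] ℂ × E} (hf : DenseRange f) (hg : DenseRange g)
    (h : ∀ m n, form (f m) (f n) = form (g m) (g n)) {m₀ : M} (hm₀ : form (f m₀) (f m₀) = 1) :
    ∃ S : U E, ∀ m, S.1 (f m) = g m := by
  obtain ⟨A, hA⟩ := exists_map_eq_basePt hm₀
  obtain ⟨B, hB⟩ := exists_map_eq_basePt ((h m₀ m₀).symm.trans hm₀)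
  have hfst : ∀ m, (A.1 (f m)).1 = (B.1 (g m)).1 := fun m => by
    rw [← form_basePt_right, ← form_basePt_right, ← hA, form_map, h, ← form_map B, hB, hA]
  have hsnd : Continuous (Prod.snd : ℂ × E → E) := continuous_snd
  have hsurj : Function.Surjective (Prod.snd : ℂ × E → E) := Prod.snd_surjective
  obtain ⟨V, hV⟩ := exists_linearIsometryEquiv
    (f := LinearMap.snd ℂ ℂ E ∘ₗ A.1.toLinearMap ∘ₗ f)
    (g := LinearMap.snd ℂ ℂ E ∘ₗ B.1.toLinearMap ∘ₗ g)
    (hsurj.denseRange.comp (denseRange_map A hf) hsnd)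
    (hsurj.denseRange.comp (denseRange_map B hg) hsnd) fun m => by
      change ‖(A.1 (f m)).2‖ = ‖(B.1 (g m)).2‖
      have h1 := form_self_re (A.1 (f m))
      have h2 := form_self_re (B.1 (g m))
      rw [form_map, h, ← form_map B, h2, hfst] at h1
      exact (pow_left_inj₀ (norm_nonneg _) (norm_nonneg _) two_ne_zero).1 (sub_right_inj.1 h1).symm
  refine ⟨B⁻¹ * ofIsometryEquiv V * A, fun m => ?_⟩
  rw [coe_mul_apply, coe_mul_apply, ofIsometryEquiv_apply, hfst]
  have h1 : V (A.1 (f m)).2 = (B.1 (g m)).2 := hV m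
  rw [h1]
  exact coe_inv_apply_apply B (g m)

/-! ### The orbit of the fixed point of the Borel subgroup -/

/-- Vectors representing the orbit of `[η₁]`, which is parametrized by the projective line
`Option ℝ`. -/
noncomputable def Rep.IsAxisPair.orbit (h : ρ.IsAxisPair η₁ η₂) : Option ℝ → ℂ × E
  | none => η₁
  | some b => (h.lift one_pos b).1 η₂

/-- Elements of `PU(1,1)` representing the cosets of the stabilizer of `[ξ₁]`. -/
noncomputable def cosetRep : Option ℝ → PU ℂ
  | none => 1
  | some b => proj (borel 1 one_pos b) * proj weyl

theorem exists_mul_cosetRep (g : PU ℂ) (i : Option ℝ) :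
    ∃ (j : Option ℝ) (l : ℝ) (hl : 0 < l) (b : ℝ),
      g * cosetRep i = cosetRep j * proj (borel l hl b) := by
  obtain ⟨l, hl, b, h⟩ | ⟨s, l, hl, b, h⟩ := bruhat (g * cosetRep i)
  · exact ⟨none, l, hl, b, by rw [h, cosetRep, one_mul]⟩
  · exact ⟨some s, l, hl, b, h⟩

theorem Rep.IsAxisPair.orbit_ne_zero (h : ρ.IsAxisPair η₁ η₂) (i : Option ℝ) : h.orbit i ≠ 0 := by
  cases i with
  | none => exact h.ne_zero.1
  | some b => exact map_ne_zero' _ h.ne_zero.2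

theorem Rep.IsAxisPair.mk_orbit (h : ρ.IsAxisPair η₁ η₂) (hρ : ρ.NonElementary) (i : Option ℝ) :
    Projectivization.mk ℂ (h.orbit i) (h.orbit_ne_zero i)
      = (ρ.hom (cosetRep i)).1 (.mk ℂ η₁ h.ne_zero.1) := by
  cases i with
  | none =>
    rw [cosetRep, map_one]
    rfl
  | some b =>
    rw [cosetRep, map_mul, PU_mul_apply, h.weyl_apply hρ, ← h.proj_lift, proj_mk]
    rfl

theorem Rep.IsAxisPair.exists_map_orbit (h : ρ.IsAxisPair η₁ η₂) (hρ : ρ.NonElementary)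
    {g : PU ℂ} {i j : Option ℝ} {l : ℝ} {hl : 0 < l} {b : ℝ}
    (hg : g * cosetRep i = cosetRep j * proj (borel l hl b)) {T : U E} (hT : proj T = ρ.hom g) :
    ∃ a : ℂ, T.1 (h.orbit i) = a • h.orbit j := by
  have h1 : (proj T).1 (.mk ℂ (h.orbit i) (h.orbit_ne_zero i))
      = .mk ℂ (h.orbit j) (h.orbit_ne_zero j) := by
    rw [hT, h.mk_orbit hρ, h.mk_orbit hρ, ← PU_mul_apply, ← map_mul, hg, map_mul, PU_mul_apply,
      Rep.mem_stab.1 (h.borel_mem_stab hl b)]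
  rw [proj_mk, Projectivization.mk_eq_mk_iff'] at h1
  obtain ⟨a, ha⟩ := h1
  exact ⟨a, ha.symm⟩

theorem isHyperbolicSubspace_of_mem {L : Submodule ℂ (ℂ × E)}
    (hL : IsClosed (L : Set (ℂ × E))) {v : ℂ × E} (hv : v ∈ L) (hv1 : form v v = 1) :
    IsHyperbolicSubspace L := by
  refine ⟨hL, fun w hw h => ?_, v, hv, by rw [hv1]; simp⟩
  by_contra hw0
  have := form_self_neg_of_orthogonal (by rw [hv1]; simp) (h v hv) hw0
  rw [h w hw] at this
  simp at this

theorem Rep.IsAxisPair.unit_mem_span (h : ρ.IsAxisPair η₁ η₂) :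
    ((Real.sqrt 2)⁻¹ : ℂ) • (η₁ + η₂) ∈ Submodule.span ℂ (Set.range h.orbit) := by
  refine Submodule.smul_mem _ _ (Submodule.add_mem _ (Submodule.subset_span ⟨none, rfl⟩)
    (Submodule.subset_span ⟨some 0, ?_⟩))
  rw [Rep.IsAxisPair.orbit, h.lift_unip_zero]
  rfl

/-- For an irreducible representation, the orbit of `[η₁]` is total: its closed span is an
invariant hyperbolic subspace. -/
theorem Rep.IsAxisPair.denseRange_orbit [CompleteSpace E] (h : ρ.IsAxisPair η₁ η₂)
    (hρ : ρ.Irreducible) : DenseRange (Finsupp.linearCombination ℂ h.orbit) := by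
  set L₀ := Submodule.span ℂ (Set.range h.orbit) with hL₀
  have hinv : ∀ (g : PU ℂ) (T : U E), proj T = ρ.hom g → ∀ v ∈ L₀.topologicalClosure,
      T.1 v ∈ L₀.topologicalClosure := by
    intro g T hT v hv
    have h1 : ∀ v ∈ L₀, T.1 v ∈ L₀ := fun v hv => by
      have h2 : L₀ ≤ L₀.comap T.1.toLinearMap := by
        rw [hL₀, Submodule.span_le]
        rintro _ ⟨i, rfl⟩
        obtain ⟨j, l, hl, b, hg⟩ := exists_mul_cosetRep g i
        obtain ⟨a, ha⟩ := h.exists_map_orbit hρ.1 hg hT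
        change T.1 (h.orbit i) ∈ Submodule.span ℂ (Set.range h.orbit)
        rw [ha]
        exact Submodule.smul_mem _ _ (Submodule.subset_span ⟨j, rfl⟩)
      exact h2 hv
    exact map_mem_closure (continuous_coe T) hv h1
  have htop : L₀.topologicalClosure = ⊤ := by
    refine hρ.2 _ (isHyperbolicSubspace_of_mem L₀.isClosed_topologicalClosure
      (L₀.le_topologicalClosure h.unit_mem_span) (form_inv_sqrt_smul_self two_pos h.form_add_self))
      fun g p hp hpL => ?_
    obtain ⟨T, hT⟩ := exists_proj_eq (ρ.hom g)
    induction p using Projectivization.ind with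
    | h v hv =>
      rw [← hT, proj_mk, Projectivization.submodule_mk, Submodule.span_singleton_le_iff_mem]
      rw [Projectivization.submodule_mk, Submodule.span_singleton_le_iff_mem] at hpL
      exact hinv g T hT v hpL
  have h3 : Set.range (Finsupp.linearCombination ℂ h.orbit) = (L₀ : Set (ℂ × E)) := by
    rw [hL₀, ← Finsupp.range_linearCombination, LinearMap.coe_range]
  rw [DenseRange, h3, dense_iff_closure_eq, ← Submodule.topologicalClosure_coe, htop]
  rfl

/-- The Gram matrix of the orbit, in terms of the kernel. -/
theorem Rep.IsAxisPair.form_orbit (h : ρ.IsAxisPair η₁ η₂) (i j : Option ℝ) :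
    form (h.orbit i) (h.orbit j) = match i, j with
      | none, none => 0
      | none, some _ => 1
      | some _, none => 1
      | some b, some b' => h.kernel (b - b') := by
  match i, j with
  | none, none => exact h.isotropic₁
  | none, some b =>
    change form η₁ ((h.lift one_pos b).1 η₂) = 1
    exact (congrArg (form · _) (h.lift_unip_eta₁ b).symm).trans
      ((form_map _ _ _).trans h.normalized)
  | some b, none =>
    change form ((h.lift one_pos b).1 η₂) η₁ = 1
    exact (congrArg (form _) (h.lift_unip_eta₁ b).symm).trans
      ((form_map _ _ _).trans h.form_swap)
  | some b, some b' => exact h.form_lift_lift b b'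

theorem Rep.IsAxisPair.form_orbit_ne_zero (h : ρ.IsAxisPair η₁ η₂) (hρ : ρ.NonElementary)
    {i j : Option ℝ} (hij : i ≠ j) : form (h.orbit i) (h.orbit j) ≠ 0 := by
  rw [h.form_orbit]
  match i, j with
  | none, none => exact absurd rfl hij
  | none, some b => exact one_ne_zero
  | some b, none => exact one_ne_zero
  | some b, some b' => exact h.kernel_ne_zero hρ (sub_ne_zero.2 fun e => hij (by rw [e]))

/-- A unitary map preserving every line of the orbit is a scalar: the eigenvalues at two points of
the orbit have the same product with the conjugate of the eigenvalue at a third point. -/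
theorem Rep.IsAxisPair.exists_eq_smul_of_orbit [CompleteSpace E] (h : ρ.IsAxisPair η₁ η₂)
    (hρ : ρ.Irreducible) {R : U E} (hR : ∀ i, ∃ a : ℂ, R.1 (h.orbit i) = a • h.orbit i) :
    ∃ c : ℂ, ∀ v, R.1 v = c • v := by
  choose a ha using hR
  have h1 : ∀ i j, i ≠ j → a i * conj (a j) = 1 := fun i j hij => by
    have h2 := form_map R (h.orbit i) (h.orbit j)
    rw [ha, ha, form_smul_left, form_smul_right, ← mul_assoc] at h2
    exact mul_right_cancel₀ (h.form_orbit_ne_zero hρ.1 hij) (h2.trans (one_mul _).symm)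
  have h2 : ∀ i j k, i ≠ k → j ≠ k → a i = a j := fun i j k hik hjk => by
    have h3 := h1 i k hik
    exact mul_right_cancel₀ (right_ne_zero_of_mul_eq_one h3) (h3.trans (h1 j k hjk).symm)
  have h3 : ∀ i, a i = a none := fun i => by
    by_cases hi : i = some 0
    · exact h2 i none (some 1) (by simp [hi]) (by simp)
    · exact h2 i none (some 0) hi (by simp)
  refine ⟨a none, fun v => ?_⟩
  refine (h.denseRange_orbit hρ).induction_on v
    (isClosed_eq (continuous_coe R) (continuous_const_smul _)) fun m => ?_
  rw [Finsupp.linearCombination_apply, Finsupp.sum, map_sum, Finset.smul_sum]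
  refine Finset.sum_congr rfl fun i _ => ?_
  rw [map_smul, ha, h3, smul_comm]

theorem form_linearCombination {ι : Type*} (f : ι → ℂ × E) (m n : ι →₀ ℂ) :
    form (Finsupp.linearCombination ℂ f m) (Finsupp.linearCombination ℂ f n)
      = m.sum fun i a => n.sum fun j b => a * (conj b * form (f i) (f j)) := by
  have hl : ∀ (s : Finset ι) (x : ι → ℂ × E) (y : ℂ × E),
      form (∑ i ∈ s, x i) y = ∑ i ∈ s, form (x i) y := fun s x y => by
    classical
    induction s using Finset.induction_on with
    | empty => simp
    | insert i s hi ih => rw [Finset.sum_insert hi, Finset.sum_insert hi, form_add_left, ih]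
  have hr : ∀ (s : Finset ι) (x : ι → ℂ × E) (y : ℂ × E),
      form y (∑ i ∈ s, x i) = ∑ i ∈ s, form y (x i) := fun s x y => by
    rw [← conj_form, hl, map_sum]
    simp only [conj_form]
  rw [Finsupp.linearCombination_apply, Finsupp.linearCombination_apply, Finsupp.sum, hl]
  refine Finset.sum_congr rfl fun i _ => ?_
  rw [form_smul_left, Finsupp.sum, hr, Finset.mul_sum]
  refine Finset.sum_congr rfl fun j _ => ?_
  rw [form_smul_right]

/-! ### The classification -/

/-- Irreducible representations with the same kernel are conjugate: the unitary map between the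
orbits of the fixed points of the Borel subgroup intertwines the representations, because a
projective transformation is determined by its action on the orbit. -/
theorem Rep.IsAxisPair.conj_of_kernel_eq [CompleteSpace E] {ρ₁ ρ₂ : Rep E} {η₁ η₂ ζ₁ ζ₂ : ℂ × E}
    (h₁ : ρ₁.IsAxisPair η₁ η₂) (h₂ : ρ₂.IsAxisPair ζ₁ ζ₂) (hρ₁ : ρ₁.Irreducible)
    (hρ₂ : ρ₂.Irreducible) (hK : ∀ b, h₁.kernel b = h₂.kernel b) : ρ₁.Conj ρ₂ := by
  have hgram : ∀ i j, form (h₁.orbit i) (h₁.orbit j) = form (h₂.orbit i) (h₂.orbit j) :=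
    fun i j => by
      rw [h₁.form_orbit, h₂.form_orbit]
      simp only [hK]
  obtain ⟨m₀, hm₀⟩ : ∃ m₀, Finsupp.linearCombination ℂ h₁.orbit m₀
      = ((Real.sqrt 2)⁻¹ : ℂ) • (η₁ + η₂) := by
    have := h₁.unit_mem_span
    rwa [← Finsupp.range_linearCombination, LinearMap.mem_range] at this
  obtain ⟨S, hS⟩ := exists_unitary_of_form_eq (h₁.denseRange_orbit hρ₁) (h₂.denseRange_orbit hρ₂)
    (fun m n => by
      rw [form_linearCombination, form_linearCombination]
      simp only [hgram]) (m₀ := m₀)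
    (by rw [hm₀, form_inv_sqrt_smul_self two_pos h₁.form_add_self])
  have hSo : ∀ i, S.1 (h₁.orbit i) = h₂.orbit i := fun i => by
    simpa using hS (Finsupp.single i 1)
  have hSo' : ∀ i, (S⁻¹).1 (h₂.orbit i) = h₁.orbit i := fun i => by
    rw [← hSo, coe_inv_apply_apply]
  refine ⟨proj S, fun g => ?_⟩
  obtain ⟨T₁, hT₁⟩ := exists_proj_eq (ρ₁.hom g)
  obtain ⟨T₂, hT₂⟩ := exists_proj_eq (ρ₂.hom g)
  obtain ⟨c, hc⟩ := h₂.exists_eq_smul_of_orbit hρ₂ (R := T₂⁻¹ * (S * T₁ * S⁻¹)) fun i => by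
    obtain ⟨j, l, hl, b, hg⟩ := exists_mul_cosetRep g i
    obtain ⟨a₁, ha₁⟩ := h₁.exists_map_orbit hρ₁.1 hg hT₁
    obtain ⟨a₂, ha₂⟩ := h₂.exists_map_orbit hρ₂.1 hg hT₂
    have ha0 : a₂ ≠ 0 := by
      rintro rfl
      rw [zero_smul] at ha₂
      exact map_ne_zero' T₂ (h₂.orbit_ne_zero i) ha₂
    refine ⟨a₁ * a₂⁻¹, ?_⟩
    have h3 : h₂.orbit j = a₂⁻¹ • T₂.1 (h₂.orbit i) := by
      rw [ha₂, smul_smul, inv_mul_cancel₀ ha0, one_smul]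
    rw [coe_mul_apply, coe_mul_apply, coe_mul_apply, hSo', ha₁, map_smul, hSo, h3, map_smul,
      map_smul, coe_inv_apply_apply, smul_smul]
  have h4 : proj (S * T₁ * S⁻¹) = proj T₂ := proj_eq_of_eq_smul (c := c) fun v => by
    rw [← map_smul, ← hc, ← coe_mul_apply, mul_inv_cancel_left]
  rw [← hT₁, ← hT₂, ← h4]
  simp only [map_mul, map_inv]

theorem Rep.Irreducible.conj_of_invariants_eq [CompleteSpace E] {ρ₁ ρ₂ : Rep E}
    (hρ₁ : ρ₁.Irreducible) (hρ₂ : ρ₂.Irreducible) (hd : ρ₁.displacement = ρ₂.displacement)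
    (ha : ρ₁.angle = ρ₂.angle) : ρ₁.Conj ρ₂ := by
  obtain ⟨η₁, η₂, h₁⟩ := hρ₁.1.exists_isAxisPair
  obtain ⟨ζ₁, ζ₂, h₂⟩ := hρ₂.1.exists_isAxisPair
  have t₁ := (h₁.hasDisplacement_iff hρ₁.1).1 hρ₁.1.hasDisplacement
  have t₂ := (h₂.hasDisplacement_iff hρ₂.1).1 hρ₂.1.hasDisplacement
  rw [← hd] at t₂
  have a₁ := (h₁.hasAngle_iff hρ₁.1).1 hρ₁.1.hasAngle
  have a₂ := (h₂.hasAngle_iff hρ₂.1).1 hρ₂.1.hasAngle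
  have n₁ := norm_pos_iff.2 (h₁.kernel_ne_zero hρ₁.1 one_ne_zero)
  have n₂ := norm_pos_iff.2 (h₂.kernel_ne_zero hρ₂.1 one_ne_zero)
  -- The scaling factor that makes the absolute values of the two kernels at `1` equal.
  set c : ℂ := ((Real.sqrt (‖h₂.kernel 1‖ / ‖h₁.kernel 1‖) : ℝ) : ℂ) with hc
  have hpos : 0 < Real.sqrt (‖h₂.kernel 1‖ / ‖h₁.kernel 1‖) := Real.sqrt_pos.2 (by positivity)
  have hc0 : c ≠ 0 := Complex.ofReal_ne_zero.2 hpos.ne'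
  have h₃ := h₂.smul hc0
  have t₃ : ∀ (l : ℝ) (hl : 0 < l), h₃.char hl 0 = l ^ ρ₁.displacement := fun l hl => by
    rw [h₂.char_smul hc0, t₂]
  have hK1 : h₁.kernel 1 = h₃.kernel 1 := by
    rw [h₂.kernel_smul hc0]
    have hs : ‖c‖⁻¹ ^ 2 = ‖h₁.kernel 1‖ / ‖h₂.kernel 1‖ := by
      rw [hc, Complex.norm_real, Real.norm_of_nonneg hpos.le, inv_pow, Real.sq_sqrt (by positivity),
        inv_div]
    rw [hs]
    refine Complex.ext_norm_arg ?_ ?_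
    · rw [norm_mul, Complex.norm_real, Real.norm_of_nonneg (by positivity),
        div_mul_cancel₀ _ n₂.ne']
    · rw [Complex.arg_real_mul _ (by positivity), ← a₁, ← a₂, ha]
  have hpos : ∀ b : ℝ, 0 < b → h₁.kernel b = h₃.kernel b := fun b hb => by
    rw [h₁.kernel_eq t₁ hb, h₃.kernel_eq t₃ hb, hK1]
  refine h₁.conj_of_kernel_eq h₃ hρ₁ hρ₂ fun b => ?_
  obtain hb | rfl | hb := lt_trichotomy b 0
  · rw [← neg_neg b, h₁.kernel_neg, h₃.kernel_neg, hpos _ (neg_pos.2 hb)]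
  · rw [h₁.kernel_zero, h₃.kernel_zero]
  · exact hpos b hb

end CHyp

theorem mainTheorem2 {E : Type*} [NormedAddCommGroup E] [InnerProductSpace ℂ E] [CompleteSpace E]
    [TopologicalSpace.SeparableSpace E] (hE : ¬ FiniteDimensional ℂ E) :
    (∀ ρ : CHyp.Rep E, ρ.Irreducible →
      (∃! t : ℝ, ρ.HasDisplacement t) ∧ (∃! θ : ℝ, ρ.HasAngle θ)) ∧
    ∀ ρ₁ ρ₂ : CHyp.Rep E, ρ₁.Irreducible → ρ₂.Irreducible →
      (ρ₁.displacement = ρ₂.displacement → (ρ₁.Conj ρ₂ ↔ ρ₁.angle = ρ₂.angle)) ∧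
      (ρ₁.Conj ρ₂ ↔ ρ₁.displacement = ρ₂.displacement ∧ ρ₁.angle = ρ₂.angle) := by
  refine ⟨fun ρ hρ => ⟨hρ.1.existsUnique_hasDisplacement, hρ.1.existsUnique_hasAngle⟩,
    fun ρ₁ ρ₂ h₁ h₂ => ?_⟩
  have h : ρ₁.Conj ρ₂ ↔ ρ₁.displacement = ρ₂.displacement ∧ ρ₁.angle = ρ₂.angle :=
    ⟨fun hc => hc.invariants_eq h₁.1 h₂.1, fun ⟨hd, ha⟩ => h₁.conj_of_invariants_eq h₂ hd ha⟩
  exact ⟨fun hd => h.trans (and_iff_right hd), h⟩
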